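/- **Setting.** Let $\mathcal G$ be a set, $\mathbb F$ the free non-unital complex $*$-algebra generated by $\mathcal G$, and $\mathcal R\subset\mathbb F$ a set of relations ($r=0$ for $r\in\mathcal R$). A representation of $(\mathcal G,\mathcal R)$ is a family $\pi=\{\pi(g)\}_{g\in\mathcal G}$ of bounded operators on a complex Hilbert space that satisfies the relations; it extends to $\mathbb F$, it is *faithful* if $\pi(g)\ne 0$ for all $g\in\mathcal G$, and $C^*(\pi)$ is the $C^*$-algebra generated by the $\pi(g)$. Assume that $(\mathcal G,\mathcal R)$ is *non-degenerate* (it has a faithful representation) and *admissible*: $|||w|||:=\sup_\pi\|\pi(w)\|<\infty$ for every $w\in\mathbb F$. Let $\mathbb I=\{w:|||w|||=0\}$ and let $C^*(\mathcal G,\mathcal R)$ be the completion of $\mathbb F/\mathbb I$ in $|||\cdot|||$. The pair has the *uniqueness property* if for any two faithful representations $\pi_1,\pi_2$ the map $\pi_1(g)\mapsto\pi_2(g)$ extends to an isomorphism $C^*(\pi_1)\cong C^*(\pi_2)$. Let $\gamma$ be a circle gauge action on $C^*(\mathcal G,\mathcal R)$, that is, the action induced by $\gamma_z(g)=\varphi(z)_g\,g$,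 where $\varphi:\mathbb T\to\mathbb T^{\mathcal G}$ is a continuous homomorphism (for instance an isomorphism onto a closed subgroup) such that every $\gamma_z$ leaves $\mathbb I$ invariant. Put $\mathcal B_n=\{b\in C^*(\mathcal G,\mathcal R):\gamma_z(b)=z^n b \text{ for all } z\in\mathbb T\}$. The action $\gamma$ is *semi-saturated* if $C^*(\mathcal G,\mathcal R)$ is generated as a $C^*$-algebra by $\mathcal B_0\cup\mathcal B_1$, and $(\mathcal G,\mathcal R,\gamma)$ has the *gauge-invariance uniqueness property* if for every faithful representation of $(\mathcal G,\mathcal R)$ its extension to $C^*(\mathcal G,\mathcal R)$ is injective on $\mathcal B_0$. Let $\mathcal G_\gamma=(\mathcal B_0\cup\mathcal B_1)\setminus\{0\}$, and let $\mathcal R_\gamma$ consist of all algebraic relations of the Hilbert bimodule $(\mathcal B_0,\mathcal B_1)$: the linear relations of $\mathcal B_0$ and of $\mathcal B_1$, the product and the involution of $\mathcal B_0$, the left and right actions of $\mathcal B_0$ on $\mathcal B_1$, and the inner products $a^*b$ and $ab^*$ $(a,b\in\mathcal B_1)$ with values in $\mathcal B_0$ (wherever the element $0$ of $\mathcal B_0\cup\mathcal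 B_1$ occurs in a relation it is read as the zero of the free $*$-algebra). The pair $(\mathcal G_\gamma,\mathcal R_\gamma)$ is admissible, and the crossed product of $\mathcal B_0$ by the Hilbert bimodule $\mathcal B_1$ is $\mathcal B_1\rtimes_{\mathcal B_0}\mathbb Z:=C^*(\mathcal G_\gamma,\mathcal R_\gamma)$. **Proposition.** There is a unique $*$-homomorphism $\Phi:\mathcal B_1\rtimes_{\mathcal B_0}\mathbb Z\to C^*(\mathcal G,\mathcal R)$ that sends the generator corresponding to $b$ to $b$, for every $b\in\mathcal G_\gamma$. It is injective, and it is an isomorphism if and only if $\gamma$ is semi-saturated. The pair $(\mathcal G_\gamma,\mathcal R_\gamma)$ is non-degenerate. Moreover, if $\gamma$ is semi-saturated, then the following conditions are equivalent: i) $(\mathcal G,\mathcal R)$ has the uniqueness property; ii) $(\mathcal G,\mathcal R,\gamma)$ has the gauge-invariance uniqueness property and $(\mathcal G_\gamma,\mathcal R_\gamma)$ has the uniqueness property. -/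

import Mathlib

open scoped ComplexConjugate

set_option linter.unusedSectionVars false

universe u

noncomputable section

namespace GenRel

/-! ### The free non-unital `*`-algebra on a set of generators -/

/-- Non-empty words in the letters `g = (g, false)` and `g^* = (g, true)`, `g : G`. -/
abbrev Word (G : Type u) : Type u := FreeSemigroup (G × Bool)

/-- The adjoint of a word: reverse its order and exchange `g` with `g^*`. -/
def starWord {G : Type u} (w : Word G) : Word G :=
  (FreeSemigroup.lift (fun p : G × Bool =>
    MulOpposite.op (FreeSemigroup.of (p.1, !p.2))) w).unop

@[simp] lemma starWord_of {G : Type u} (g : G) (b : Bool) :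
    starWord (FreeSemigroup.of (g, b)) = FreeSemigroup.of (g, !b) := rfl

@[simp] lemma starWord_mul {G : Type u} (v w : Word G) :
    starWord (v * w) = starWord w * starWord v := by
  simp [starWord]

@[simp] lemma starWord_starWord {G : Type u} (w : Word G) : starWord (starWord w) = w := by
  induction w using FreeSemigroup.recOnMul with
  | ih1 p => rcases p with ⟨g, b⟩; simp
  | ih2 p w hp hw => rw [starWord_mul, starWord_mul, hw, hp]

/-- The free non-unital (complex) `*`-algebra generated by `G`: finite linear combinations of
non-empty words in `g` and `g^*`. -/
def FreeStarAlg (G : Type u) : Type u := MonoidAlgebra ℂ (Word G)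

namespace FreeStarAlg

variable {G : Type u}

instance : NonUnitalRing (FreeStarAlg G) :=
  inferInstanceAs (NonUnitalRing (MonoidAlgebra ℂ (Word G)))

instance : Module ℂ (FreeStarAlg G) :=
  inferInstanceAs (Module ℂ (MonoidAlgebra ℂ (Word G)))

instance : IsScalarTower ℂ (FreeStarAlg G) (FreeStarAlg G) :=
  inferInstanceAs (IsScalarTower ℂ (MonoidAlgebra ℂ (Word G)) (MonoidAlgebra ℂ (Word G)))

instance : SMulCommClass ℂ (FreeStarAlg G) (FreeStarAlg G) :=
  inferInstanceAs (SMulCommClass ℂ (MonoidAlgebra ℂ (Word G)) (MonoidAlgebra ℂ (Word G)))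

/-- The monomial `c • w`. -/
def mono (w : Word G) (c : ℂ) : FreeStarAlg G := MonoidAlgebra.single w c

lemma mono_mul_mono (v w : Word G) (a b : ℂ) : mono v a * mono w b = mono (v * w) (a * b) :=
  MonoidAlgebra.single_mul_single ..

lemma smul_mono (w : Word G) (a b : ℂ) : a • mono w b = mono w (a * b) :=
  MonoidAlgebra.smul_single' ..

lemma induction_mono {p : FreeStarAlg G → Prop} (x : FreeStarAlg G) (zero : p 0)
    (add : ∀ x y, p x → p y → p (x + y)) (mono : ∀ w c, p (mono w c)) : p x :=
  MonoidAlgebra.induction_linear (motive := p) x zero add mono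

/-- The conjugate-linear additive map `c • w ↦ conj c • w^*`. -/
def starHom : FreeStarAlg G →+ FreeStarAlg G :=
  AddMonoidHom.comp
    (Finsupp.liftAddHom fun w =>
      (MonoidAlgebra.singleAddHom (starWord w) : ℂ →+ MonoidAlgebra ℂ (Word G)).comp
        (starRingEnd ℂ : ℂ →+ ℂ))
    (MonoidAlgebra.coeffAddEquiv (R := ℂ) (M := Word G)).toAddMonoidHom

lemma starHom_mono (w : Word G) (c : ℂ) : starHom (mono w c) = mono (starWord w) (conj c) := by
  exact Finsupp.liftAddHom_apply_single (N := MonoidAlgebra ℂ (Word G)) _ _ _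

instance : StarRing (FreeStarAlg G) where
  star := starHom
  star_involutive x := by
    induction x using induction_mono with
    | zero => simp
    | add x y hx hy => rw [map_add, map_add, hx, hy]
    | mono w c => simp [starHom_mono]
  star_mul x y := by
    induction x using induction_mono with
    | zero => simp
    | add x x' hx hx' => rw [add_mul, map_add, hx, hx', map_add, mul_add]
    | mono v a =>
      induction y using induction_mono with
      | zero => simp
      | add y y' hy hy' => rw [mul_add, map_add, hy, hy', map_add, add_mul]
      | mono w b =>
        rw [mono_mul_mono, starHom_mono, starHom_mono, starHom_mono, mono_mul_mono,
          starWord_mul, map_mul, mul_comm]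
  star_add := map_add starHom

lemma star_mono (w : Word G) (c : ℂ) : star (mono w c) = mono (starWord w) (conj c) :=
  starHom_mono w c

instance : StarModule ℂ (FreeStarAlg G) where
  star_smul c x := by
    induction x using induction_mono with
    | zero => simp
    | add x y hx hy => rw [smul_add, star_add, hx, hy, star_add, smul_add]
    | mono w b =>
      rw [smul_mono, star_mono, star_mono, smul_mono, map_mul]; rfl

/-- The canonical generators. -/
def gen (g : G) : FreeStarAlg G := mono (FreeSemigroup.of (g, false)) 1

section lift

variable {A : Type*} [NonUnitalRing A] [StarRing A] [Module ℂ A] [IsScalarTower ℂ A A]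
  [SMulCommClass ℂ A A] [StarModule ℂ A]

/-- The evaluation of words at a family `f : G → A`. -/
def wordHom (f : G → A) : Word G →ₙ* A :=
  FreeSemigroup.lift fun p => if p.2 then star (f p.1) else f p.1

lemma wordHom_starWord (f : G → A) (w : Word G) :
    wordHom f (starWord w) = star (wordHom f w) := by
  induction w using FreeSemigroup.recOnMul with
  | ih1 p => rcases p with ⟨g, _ | _⟩ <;> simp [wordHom]
  | ih2 p w hp hw => rw [starWord_mul, map_mul, map_mul, star_mul, hp, hw]

/-- The linear extension of `wordHom`. -/
def liftAlg (f : G → A) : FreeStarAlg G →ₙₐ[ℂ] A :=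
  (MonoidAlgebra.liftMagma ℂ (wordHom f) : MonoidAlgebra ℂ (Word G) →ₙₐ[ℂ] A)

lemma liftAlg_mono (f : G → A) (w : Word G) (c : ℂ) :
    liftAlg f (mono w c) = c • wordHom f w := by
  change MonoidAlgebra.liftMagma ℂ (wordHom f) (MonoidAlgebra.single w c) = _
  simp

/-- The unique `*`-homomorphism that extends `f : G → A` to the free `*`-algebra. -/
def lift (f : G → A) : FreeStarAlg G →⋆ₙₐ[ℂ] A :=
  { liftAlg f with
    map_star' := fun x => by
      change liftAlg f (star x) = star (liftAlg f x)
      induction x using induction_mono with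
      | zero => simp
      | add x y hx hy => rw [star_add, map_add, hx, hy, map_add, star_add]
      | mono w c =>
        rw [star_mono, liftAlg_mono, liftAlg_mono, wordHom_starWord, star_smul]; rfl }

@[simp] lemma lift_gen (f : G → A) (g : G) : lift f (gen g) = f g := by
  change liftAlg f (mono _ _) = _
  rw [liftAlg_mono, one_smul]; rfl

lemma lift_mono (f : G → A) (w : Word G) (c : ℂ) :
    lift f (mono w c) = c • wordHom f w := liftAlg_mono f w c

lemma hom_ext {φ ψ : FreeStarAlg G →⋆ₙₐ[ℂ] A} (h : ∀ g, φ (gen g) = ψ (gen g)) : φ = ψ := by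
  have hw : ∀ w : Word G, φ (mono w 1) = ψ (mono w 1) := by
    intro w
    induction w using FreeSemigroup.recOnMul with
    | ih1 p =>
      rcases p with ⟨g, _ | _⟩
      · exact h g
      · have : (mono (FreeSemigroup.of (g, true)) 1 : FreeStarAlg G) = star (gen g) := by
          simp [gen, star_mono]
        rw [this, map_star, map_star, h]
    | ih2 p w hp hw =>
      have : (mono (FreeSemigroup.of p * w) 1 : FreeStarAlg G)
          = mono (FreeSemigroup.of p) 1 * mono w 1 := by simp [mono_mul_mono]
      rw [this, map_mul, map_mul, hp, hw]
  refine NonUnitalStarAlgHom.ext fun x => ?_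
  induction x using induction_mono with
  | zero => simp
  | add x y hx hy => rw [map_add, map_add, hx, hy]
  | mono w c =>
    have : (mono w c : FreeStarAlg G) = c • mono w 1 := by simp [smul_mono]
    rw [this, map_smul, map_smul, hw]

end lift

end FreeStarAlg

open FreeStarAlg

variable {G : Type u}

/-! ### Representations, admissibility, uniqueness property

A pair of generators and relations is a type `G` together with a set `R` of elements of the free
`*`-algebra; `r ∈ R` stands for the relation `r = 0`. -/

/-- A representation of `(G, R)`: bounded operators on a complex Hilbert space that satisfy the
relations. -/
structure Representation (R : Set (FreeStarAlg G)) where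
  H : Type u
  [normed : NormedAddCommGroup H]
  [inner : InnerProductSpace ℂ H]
  [complete : CompleteSpace H]
  op : G → H →L[ℂ] H
  sat : ∀ r ∈ R, FreeStarAlg.lift op r = 0

attribute [instance] Representation.normed Representation.inner Representation.complete

namespace Representation

variable {R : Set (FreeStarAlg G)}

/-- The extension of a representation to the free `*`-algebra. -/
def eval (π : Representation R) : FreeStarAlg G →⋆ₙₐ[ℂ] (π.H →L[ℂ] π.H) :=
  FreeStarAlg.lift π.op

/-- A representation is faithful if it does not vanish on any generator. -/
def Faithful (π : Representation R) : Prop := ∀ g, π.op g ≠ 0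

/-- `C^*(π)`, the `C^*`-algebra generated by the operators `π(g)`. -/
def cstar (π : Representation R) : NonUnitalStarSubalgebra ℂ (π.H →L[ℂ] π.H) :=
  (NonUnitalStarAlgebra.adjoin ℂ (Set.range π.op)).topologicalClosure

lemma op_mem_cstar (π : Representation R) (g : G) : π.op g ∈ π.cstar :=
  NonUnitalStarSubalgebra.le_topologicalClosure _
    (NonUnitalStarAlgebra.subset_adjoin ℂ _ ⟨g, rfl⟩)

end Representation

/-- `(G, R)` is non-degenerate: it has a faithful representation. -/
def NonDegenerate (R : Set (FreeStarAlg G)) : Prop := ∃ π : Representation R, π.Faithful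

/-- `(G, R)` is admissible: `sup {‖π(w)‖ : π a representation}` is finite for every `w`. -/
class Admissible (R : Set (FreeStarAlg G)) : Prop where
  bdd : ∀ w, BddAbove (Set.range fun π : Representation R => ‖π.eval w‖)

/-- Uniqueness property: for any two faithful representations, `π₁(g) ↦ π₂(g)` extends to an
isomorphism `C^*(π₁) ≅ C^*(π₂)`. -/
def UniquenessProperty (R : Set (FreeStarAlg G)) : Prop :=
  ∀ π₁ π₂ : Representation R, π₁.Faithful → π₂.Faithful →
    ∃ e : π₁.cstar ≃⋆ₐ[ℂ] π₂.cstar,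
      ∀ g, e ⟨π₁.op g, π₁.op_mem_cstar g⟩ = ⟨π₂.op g, π₂.op_mem_cstar g⟩

lemma Admissible.of_bound {R : Set (FreeStarAlg G)} (c : G → ℝ)
    (h : ∀ (π : Representation R) g, ‖π.op g‖ ≤ c g) : Admissible R := by
  have hw : ∀ w : Word G, ∃ C, ∀ π : Representation R, ‖wordHom π.op w‖ ≤ C := by
    intro w
    induction w using FreeSemigroup.recOnMul with
    | ih1 p =>
      rcases p with ⟨g, _ | _⟩
      · exact ⟨c g, fun π => by simpa [wordHom] using h π g⟩
      · exact ⟨c g, fun π => by simpa [wordHom] using h π g⟩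
    | ih2 p w hp hw =>
      obtain ⟨C, hC⟩ := hp
      obtain ⟨D, hD⟩ := hw
      refine ⟨C * D, fun π => ?_⟩
      rw [map_mul]
      exact (norm_mul_le _ _).trans (mul_le_mul (hC π) (hD π) (norm_nonneg _)
        ((norm_nonneg _).trans (hC π)))
  have hx : ∀ x : FreeStarAlg G, ∃ C, ∀ π : Representation R, ‖π.eval x‖ ≤ C := by
    intro x
    induction x using induction_mono with
    | zero => exact ⟨0, fun π => by simp⟩
    | add x y hx hy =>
      obtain ⟨C, hC⟩ := hx
      obtain ⟨D, hD⟩ := hy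
      refine ⟨C + D, fun π => ?_⟩
      rw [map_add]
      exact (norm_add_le _ _).trans (add_le_add (hC π) (hD π))
    | mono w a =>
      obtain ⟨C, hC⟩ := hw w
      refine ⟨‖a‖ * C, fun π => ?_⟩
      rw [Representation.eval, lift_mono, norm_smul]
      exact mul_le_mul_of_nonneg_left (hC π) (norm_nonneg a)
  refine ⟨fun x => ?_⟩
  obtain ⟨C, hC⟩ := hx x
  exact ⟨C, by rintro _ ⟨π, rfl⟩; exact hC π⟩

/-! ### The universal `C^*`-algebra -/

/-- The seminorm `|||w||| = sup {‖π(w)‖ : π a representation of (G, R)}`. -/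
def univNorm (R : Set (FreeStarAlg G)) (w : FreeStarAlg G) : ℝ :=
  ⨆ π : Representation R, ‖π.eval w‖

/-- The kernel of `|||·|||`. -/
def nullIdeal (R : Set (FreeStarAlg G)) : Set (FreeStarAlg G) := {w | univNorm R w = 0}

section univ

variable (R : Set (FreeStarAlg G))

instance : Nonempty (Representation R) :=
  ⟨{ H := PUnit, op := 0, sat := fun _ _ => Subsingleton.elim _ _ }⟩

lemma univNorm_nonneg (w : FreeStarAlg G) : 0 ≤ univNorm R w :=
  Real.iSup_nonneg fun _ => norm_nonneg _

variable {R} in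
lemma univNorm_le {w : FreeStarAlg G} {c : ℝ} (h : ∀ π : Representation R, ‖π.eval w‖ ≤ c) :
    univNorm R w ≤ c := ciSup_le h

variable [hR : Admissible R]

variable {R} in
lemma norm_eval_le (π : Representation R) (w : FreeStarAlg G) : ‖π.eval w‖ ≤ univNorm R w :=
  le_ciSup (hR.bdd w) π

lemma univNorm_mul_le (v w : FreeStarAlg G) :
    univNorm R (v * w) ≤ univNorm R v * univNorm R w :=
  univNorm_le fun π => by
    rw [map_mul]
    exact (norm_mul_le _ _).trans (mul_le_mul (norm_eval_le π v) (norm_eval_le π w)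
      (norm_nonneg _) (univNorm_nonneg R v))

lemma univNorm_star (w : FreeStarAlg G) : univNorm R (star w) = univNorm R w := by
  simp [univNorm, map_star]

lemma univNorm_sq_le (w : FreeStarAlg G) :
    univNorm R w * univNorm R w ≤ univNorm R (star w * w) := by
  have h : univNorm R w ≤ Real.sqrt (univNorm R (star w * w)) := univNorm_le fun π => by
    refine Real.le_sqrt_of_sq_le ?_
    rw [sq, ← CStarRing.norm_star_mul_self, ← map_star, ← map_mul]
    exact norm_eval_le π _
  calc _ ≤ _ := mul_self_le_mul_self (univNorm_nonneg R w) h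
    _ = _ := Real.mul_self_sqrt (univNorm_nonneg R _)

/-- The free `*`-algebra, equipped with the seminorm `|||·|||`. -/
def PreUniv (R : Set (FreeStarAlg G)) : Type u :=
  have _ := R; FreeStarAlg G

namespace PreUniv

instance : NonUnitalRing (PreUniv R) := inferInstanceAs (NonUnitalRing (FreeStarAlg G))
instance : Module ℂ (PreUniv R) := inferInstanceAs (Module ℂ (FreeStarAlg G))
instance : IsScalarTower ℂ (PreUniv R) (PreUniv R) :=
  inferInstanceAs (IsScalarTower ℂ (FreeStarAlg G) (FreeStarAlg G))
instance : SMulCommClass ℂ (PreUniv R) (PreUniv R) :=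
  inferInstanceAs (SMulCommClass ℂ (FreeStarAlg G) (FreeStarAlg G))
instance : StarRing (PreUniv R) := inferInstanceAs (StarRing (FreeStarAlg G))
instance : StarModule ℂ (PreUniv R) := inferInstanceAs (StarModule ℂ (FreeStarAlg G))

/-- The identity map to the free `*`-algebra. -/
def toFree : PreUniv R →⋆ₙₐ[ℂ] FreeStarAlg G :=
  (NonUnitalStarAlgHom.id ℂ (FreeStarAlg G) : FreeStarAlg G →⋆ₙₐ[ℂ] FreeStarAlg G)

/-- The identity map from the free `*`-algebra. -/
def ofFree : FreeStarAlg G →⋆ₙₐ[ℂ] PreUniv R :=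
  (NonUnitalStarAlgHom.id ℂ (FreeStarAlg G) : FreeStarAlg G →⋆ₙₐ[ℂ] FreeStarAlg G)

@[simp] lemma toFree_ofFree (w : FreeStarAlg G) : toFree R (ofFree R w) = w := rfl

instance : SeminormedAddCommGroup (PreUniv R) :=
  AddGroupSeminorm.toSeminormedAddCommGroup
    { toFun := fun w => univNorm R (toFree R w)
      map_zero' := by simp [univNorm]
      add_le' := fun v w => univNorm_le fun π => by
        rw [map_add, map_add]
        exact (norm_add_le _ _).trans (add_le_add (norm_eval_le π _) (norm_eval_le π _))
      neg' := fun w => by simp [univNorm] }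

lemma norm_def (w : PreUniv R) : ‖w‖ = univNorm R (toFree R w) := rfl

instance : NonUnitalSeminormedRing (PreUniv R) :=
  { (inferInstance : NonUnitalRing (PreUniv R)),
    (inferInstance : SeminormedAddCommGroup (PreUniv R)) with
    norm_mul_le := fun v w => by
      rw [norm_def, norm_def, norm_def, map_mul]
      exact univNorm_mul_le R _ _ }

instance : NormedSpace ℂ (PreUniv R) where
  norm_smul_le c w := univNorm_le fun π => by
    rw [map_smul, map_smul, norm_smul]
    exact mul_le_mul_of_nonneg_left (norm_eval_le π _) (norm_nonneg c)

instance : NormedStarGroup (PreUniv R) where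
  norm_star_le w := by
    rw [norm_def, norm_def, map_star]
    exact (univNorm_star R _).le

lemma norm_mul_self_le (w : PreUniv R) : ‖w‖ * ‖w‖ ≤ ‖star w * w‖ := by
  rw [norm_def, norm_def, map_mul, map_star]
  exact univNorm_sq_le R _

end PreUniv

/-- The universal `C^*`-algebra `C^*(G, R)`: the Hausdorff completion of the free `*`-algebra with
respect to `|||·|||`, that is, the completion of the quotient by the kernel of `|||·|||`. -/
abbrev UnivCStar : Type u := UniformSpace.Completion (PreUniv R)

namespace UnivCStar

open UniformSpace

/-- The canonical map from the free `*`-algebra. -/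
def of (w : FreeStarAlg G) : UnivCStar R :=
  (PreUniv.ofFree R w : Completion (PreUniv R))

/-- The same map, as an isometric linear map on the seminormed space. -/
def ofₗᵢ : PreUniv R →ₗᵢ[ℂ] UnivCStar R :=
  (Completion.toComplₗᵢ : PreUniv R →ₗᵢ[ℂ] Completion (PreUniv R))

lemma isDenseInducing_of : IsDenseInducing (ofₗᵢ R) := Completion.isDenseInducing_coe

variable {R}

@[elab_as_elim]
lemma induction_on {p : UnivCStar R → Prop} (x : UnivCStar R) (hp : IsClosed {x | p x})
    (ih : ∀ w, p (ofₗᵢ R w)) : p x :=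
  Completion.induction_on x hp ih

@[elab_as_elim]
lemma induction_on₂ {p : UnivCStar R → UnivCStar R → Prop} (x y : UnivCStar R)
    (hp : IsClosed {x : UnivCStar R × UnivCStar R | p x.1 x.2})
    (ih : ∀ v w, p (ofₗᵢ R v) (ofₗᵢ R w)) : p x y :=
  Completion.induction_on₂ x y hp ih

@[elab_as_elim]
lemma induction_on₃ {p : UnivCStar R → UnivCStar R → UnivCStar R → Prop} (x y z : UnivCStar R)
    (hp : IsClosed {x : UnivCStar R × UnivCStar R × UnivCStar R | p x.1 x.2.1 x.2.2})
    (ih : ∀ u v w, p (ofₗᵢ R u) (ofₗᵢ R v) (ofₗᵢ R w)) : p x y z :=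
  Completion.induction_on₃ x y z hp ih

instance : Mul (UnivCStar R) :=
  ⟨Function.curry (((isDenseInducing_of R).prodMap (isDenseInducing_of R)).extend
    fun p : PreUniv R × PreUniv R => ofₗᵢ R (p.1 * p.2))⟩

lemma of_mul' (v w : PreUniv R) : ofₗᵢ R (v * w) = ofₗᵢ R v * ofₗᵢ R w :=
  (((isDenseInducing_of R).prodMap (isDenseInducing_of R)).extend_eq
    ((ofₗᵢ R).continuous.comp continuous_mul) (v, w)).symm

instance : ContinuousMul (UnivCStar R) where
  continuous_mul := by
    let m := (AddMonoidHom.mul : PreUniv R →+ PreUniv R →+ PreUniv R).compr₂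
      (ofₗᵢ R).toLinearMap.toAddMonoidHom
    have : Continuous fun p : PreUniv R × PreUniv R => m p.1 p.2 :=
      (ofₗᵢ R).continuous.comp continuous_mul
    have di : IsDenseInducing (Completion.toCompl : PreUniv R → UnivCStar R) :=
      isDenseInducing_of R
    exact (di.extend_Z_bilin di this :)

instance : Star (UnivCStar R) :=
  ⟨Completion.map (star : PreUniv R → PreUniv R)⟩

lemma continuous_star' : Continuous (star : UnivCStar R → UnivCStar R) :=
  Completion.continuous_map

lemma of_star' (w : PreUniv R) : ofₗᵢ R (star w) = star (ofₗᵢ R w) :=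
  (Completion.map_coe (uniformContinuous_addMonoidHom_of_continuous
    (f := (starAddEquiv : PreUniv R ≃+ PreUniv R).toAddMonoidHom) continuous_star) w).symm

instance : ContinuousStar (UnivCStar R) := ⟨continuous_star'⟩

instance : NonUnitalRing (UnivCStar R) :=
  { (inferInstance : AddCommGroup (UnivCStar R)), (inferInstance : Mul (UnivCStar R)) with
    zero_mul := fun x => induction_on x (isClosed_eq (by fun_prop) (by fun_prop)) fun w => by
      rw [← map_zero (ofₗᵢ R), ← of_mul', zero_mul]
    mul_zero := fun x => induction_on x (isClosed_eq (by fun_prop) (by fun_prop)) fun w => by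
      rw [← map_zero (ofₗᵢ R), ← of_mul', mul_zero]
    mul_assoc := fun x y z =>
      induction_on₃ x y z (isClosed_eq (by fun_prop) (by fun_prop)) fun u v w => by
        simp only [← of_mul', mul_assoc]
    left_distrib := fun x y z =>
      induction_on₃ x y z (isClosed_eq (by fun_prop) (by fun_prop)) fun u v w => by
        simp only [← of_mul', ← map_add, mul_add]
    right_distrib := fun x y z =>
      induction_on₃ x y z (isClosed_eq (by fun_prop) (by fun_prop)) fun u v w => by
        simp only [← of_mul', ← map_add, add_mul] }

instance : StarRing (UnivCStar R) where
  star_involutive x := induction_on x (isClosed_eq (by fun_prop) (by fun_prop)) fun w => by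
    rw [← of_star', ← of_star', star_star]
  star_mul x y := induction_on₂ x y (isClosed_eq (by fun_prop) (by fun_prop)) fun v w => by
    rw [← of_mul', ← of_star', star_mul, of_mul', of_star', of_star']
  star_add x y := induction_on₂ x y (isClosed_eq (by fun_prop) (by fun_prop)) fun v w => by
    rw [← map_add, ← of_star', star_add, map_add, of_star', of_star']

instance : NonUnitalNormedRing (UnivCStar R) :=
  { (inferInstance : NormedAddCommGroup (UnivCStar R)),
    (inferInstance : NonUnitalRing (UnivCStar R)) with
    norm_mul_le := fun x y =>
      induction_on₂ x y (isClosed_le (by fun_prop) (by fun_prop)) fun v w => by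
        rw [← of_mul', (ofₗᵢ R).norm_map, (ofₗᵢ R).norm_map, (ofₗᵢ R).norm_map]
        exact norm_mul_le v w }

instance : CStarRing (UnivCStar R) where
  norm_mul_self_le x := induction_on x (isClosed_le (by fun_prop) (by fun_prop)) fun w => by
    rw [← of_star', ← of_mul', (ofₗᵢ R).norm_map, (ofₗᵢ R).norm_map]
    exact PreUniv.norm_mul_self_le R w

instance : IsScalarTower ℂ (UnivCStar R) (UnivCStar R) where
  smul_assoc c x y := induction_on₂ x y (isClosed_eq
    (((continuous_const_smul c).comp continuous_fst).mul continuous_snd)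
    ((continuous_const_smul c).comp continuous_mul)) fun v w => by
    simp only [smul_eq_mul, ← map_smul, ← of_mul', smul_mul_assoc]

instance : SMulCommClass ℂ (UnivCStar R) (UnivCStar R) where
  smul_comm c x y := induction_on₂ x y (isClosed_eq
    ((continuous_const_smul c).comp continuous_mul)
    (continuous_fst.mul ((continuous_const_smul c).comp continuous_snd))) fun v w => by
    simp only [smul_eq_mul, ← map_smul, ← of_mul', mul_smul_comm]

instance : StarModule ℂ (UnivCStar R) where
  star_smul c x := induction_on x (isClosed_eq
    (continuous_star.comp (continuous_const_smul c))
    ((continuous_const_smul (star c)).comp continuous_star)) fun w => by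
    rw [← map_smul, ← of_star', star_smul, map_smul, of_star']

instance : NonUnitalCStarAlgebra (UnivCStar R) where

variable (R) in
/-- The image of a generator in `C^*(G, R)`. -/
def gen (g : G) : UnivCStar R := of R (FreeStarAlg.gen g)

section ext

variable {A : Type*} [NonUnitalCStarAlgebra A]

/-- A `*`-homomorphism on the free `*`-algebra that is dominated by `|||·|||`, as a continuous
linear map on the seminormed space. -/
def extendPre (f : FreeStarAlg G →⋆ₙₐ[ℂ] A) (hf : ∀ w, ‖f w‖ ≤ univNorm R w) :
    PreUniv R →L[ℂ] A :=
  LinearMap.mkContinuous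
    { toFun := fun w => f (PreUniv.toFree R w)
      map_add' := fun v w => by rw [map_add, map_add]
      map_smul' := fun c w => by rw [map_smul, map_smul]; rfl } 1
    (fun w => by rw [one_mul]; exact hf (PreUniv.toFree R w))

lemma extendPre_apply (f : FreeStarAlg G →⋆ₙₐ[ℂ] A) (hf : ∀ w, ‖f w‖ ≤ univNorm R w)
    (w : PreUniv R) : extendPre f hf w = f (PreUniv.toFree R w) := rfl

/-- The extension of a `*`-homomorphism dominated by `|||·|||` to `C^*(G, R)`. -/
def extend (f : FreeStarAlg G →⋆ₙₐ[ℂ] A) (hf : ∀ w, ‖f w‖ ≤ univNorm R w) :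
    UnivCStar R →⋆ₙₐ[ℂ] A :=
  have hu : UniformContinuous (extendPre f hf) := (extendPre f hf).uniformContinuous
  have hc : Continuous (Completion.extension (extendPre f hf) : UnivCStar R → A) :=
    Completion.continuous_extension
  have he : ∀ w : PreUniv R,
      (Completion.extension (extendPre f hf) : UnivCStar R → A) (ofₗᵢ R w) = extendPre f hf w :=
    fun w => Completion.extension_coe hu w
  { toFun := (Completion.extension (extendPre f hf) : UnivCStar R → A)
    map_zero' := by rw [← map_zero (ofₗᵢ R), he, map_zero]
    map_add' := fun x y =>
      induction_on₂ x y (isClosed_eq (by fun_prop) (by fun_prop)) fun v w => by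
        rw [← map_add, he, he, he, map_add]
    map_smul' := fun c x => induction_on x (isClosed_eq
      (hc.comp (continuous_const_smul c)) ((continuous_const_smul c).comp hc)) fun w => by
      rw [← map_smul, he, he, map_smul]; rfl
    map_mul' := fun x y =>
      induction_on₂ x y (isClosed_eq (by fun_prop) (by fun_prop)) fun v w => by
        rw [← of_mul', he, he, he]; simp only [extendPre_apply, map_mul]
    map_star' := fun x => induction_on x (isClosed_eq (by fun_prop) (by fun_prop)) fun w => by
      rw [← of_star', he, he]; simp only [extendPre_apply, map_star] }

lemma extend_of (f : FreeStarAlg G →⋆ₙₐ[ℂ] A) (hf : ∀ w, ‖f w‖ ≤ univNorm R w)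
    (w : FreeStarAlg G) : extend f hf (of R w) = f w :=
  Completion.extension_coe (extendPre f hf).uniformContinuous (PreUniv.ofFree R w)

end ext

end UnivCStar

variable {R} in
/-- The extension of a representation of `(G, R)` to `C^*(G, R)`. -/
def Representation.ext (π : Representation R) : UnivCStar R →⋆ₙₐ[ℂ] (π.H →L[ℂ] π.H) :=
  UnivCStar.extend π.eval (norm_eval_le π)

end univ

/-! ### Circle gauge actions -/

/-- The action of the torus `𝕋^G` on the free `*`-algebra, `γ_λ(g) = λ_g g`. -/
def torusAction (l : G → Circle) : FreeStarAlg G →⋆ₙₐ[ℂ] FreeStarAlg G :=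
  FreeStarAlg.lift fun g => (l g : ℂ) • FreeStarAlg.gen g

/-- A circle gauge action: a continuous homomorphism `𝕋 → 𝕋^G` (for instance an isomorphism onto
a closed subgroup of `𝕋^G`) such that the induced action on the free `*`-algebra leaves the kernel
of `|||·|||` invariant. -/
structure CircleGaugeAction (R : Set (FreeStarAlg G)) where
  toTorus : Circle →ₜ* (G → Circle)
  invariant : ∀ z, ∀ w ∈ nullIdeal R, torusAction (toTorus z) w ∈ nullIdeal R

section gauge

variable {R : Set (FreeStarAlg G)} [hR : Admissible R]

lemma mem_nullIdeal_of_mem {r : FreeStarAlg G} (hr : r ∈ R) : r ∈ nullIdeal R :=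
  le_antisymm (univNorm_le fun π => by
    rw [show π.eval r = 0 from π.sat r hr, norm_zero]) (univNorm_nonneg R r)

/-- The representation `g ↦ π(γ_z(g))`. -/
def CircleGaugeAction.twist (γ : CircleGaugeAction R) (π : Representation R) (z : Circle) :
    Representation R where
  H := π.H
  op g := π.eval (torusAction (γ.toTorus z) (FreeStarAlg.gen g))
  sat r hr := by
    have h : FreeStarAlg.lift
        (fun g => π.eval (torusAction (γ.toTorus z) (FreeStarAlg.gen g)))
        = π.eval.comp (torusAction (γ.toTorus z)) := FreeStarAlg.hom_ext fun g => by simp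
    rw [h, NonUnitalStarAlgHom.comp_apply]
    refine norm_le_zero_iff.1 ((norm_eval_le π _).trans (le_of_eq ?_))
    exact γ.invariant z r (mem_nullIdeal_of_mem hr)

lemma CircleGaugeAction.univNorm_torusAction_le (γ : CircleGaugeAction R) (z : Circle)
    (w : FreeStarAlg G) : univNorm R (torusAction (γ.toTorus z) w) ≤ univNorm R w :=
  univNorm_le fun π => by
    have h : (γ.twist π z).eval = π.eval.comp (torusAction (γ.toTorus z)) :=
      FreeStarAlg.hom_ext fun g => by
        rw [Representation.eval, FreeStarAlg.lift_gen]; rfl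
    have := norm_eval_le (γ.twist π z) w
    rwa [h] at this

/-- The canonical map to `C^*(G, R)` as a `*`-homomorphism. -/
def UnivCStar.ofHom (R : Set (FreeStarAlg G)) [Admissible R] :
    FreeStarAlg G →⋆ₙₐ[ℂ] UnivCStar R where
  toFun w := UnivCStar.ofₗᵢ R (PreUniv.ofFree R w)
  map_zero' := by rw [map_zero, map_zero]
  map_add' v w := by rw [map_add, map_add]
  map_smul' c w := by rw [map_smul, map_smul]; rfl
  map_mul' v w := by rw [map_mul, UnivCStar.of_mul']
  map_star' w := by rw [map_star, UnivCStar.of_star']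

lemma UnivCStar.ofHom_apply (w : FreeStarAlg G) : UnivCStar.ofHom R w = UnivCStar.of R w := rfl

lemma UnivCStar.norm_ofHom (w : FreeStarAlg G) : ‖UnivCStar.ofHom R w‖ = univNorm R w :=
  (UnivCStar.ofₗᵢ R).norm_map (PreUniv.ofFree R w)

namespace CircleGaugeAction

/-- The automorphism `γ_z` of `C^*(G, R)`. -/
def act (γ : CircleGaugeAction R) (z : Circle) : UnivCStar R →⋆ₙₐ[ℂ] UnivCStar R :=
  UnivCStar.extend ((UnivCStar.ofHom R).comp (torusAction (γ.toTorus z))) fun w => by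
    rw [NonUnitalStarAlgHom.comp_apply, UnivCStar.norm_ofHom]
    exact γ.univNorm_torusAction_le z w

lemma act_gen (γ : CircleGaugeAction R) (z : Circle) (g : G) :
    γ.act z (UnivCStar.gen R g) = (γ.toTorus z g : ℂ) • UnivCStar.gen R g := by
  rw [UnivCStar.gen, act, UnivCStar.extend_of, NonUnitalStarAlgHom.comp_apply, torusAction,
    FreeStarAlg.lift_gen, map_smul]
  rfl

/-- The spectral subspace `B_n = {b : γ_z(b) = z^n b for all z}`. -/
def spectral (γ : CircleGaugeAction R) (n : ℤ) : Submodule ℂ (UnivCStar R) where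
  carrier := {b | ∀ z : Circle, γ.act z b = ((z : ℂ) ^ n) • b}
  zero_mem' z := by simp
  add_mem' hx hy z := by rw [map_add, hx z, hy z, smul_add]
  smul_mem' c x hx z := by rw [map_smul, hx z, smul_comm]

lemma mem_spectral {γ : CircleGaugeAction R} {n : ℤ} {b : UnivCStar R} :
    b ∈ γ.spectral n ↔ ∀ z : Circle, γ.act z b = ((z : ℂ) ^ n) • b := Iff.rfl

/-- `γ` is semi-saturated: `C^*(G, R)` is generated as a `C^*`-algebra by `B_0` and `B_1`. -/
def SemiSaturated (γ : CircleGaugeAction R) : Prop :=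
  (NonUnitalStarAlgebra.adjoin ℂ
    ((γ.spectral 0 : Set (UnivCStar R)) ∪ γ.spectral 1)).topologicalClosure = ⊤

/-- Gauge-invariance uniqueness property: every faithful representation of `(G, R)` gives rise to
a faithful representation of the fixed-point algebra `B_0`. -/
def GaugeInvarianceUniqueness (γ : CircleGaugeAction R) : Prop :=
  ∀ π : Representation R, π.Faithful → Set.InjOn π.ext (γ.spectral 0 : Set (UnivCStar R))

/-! ### The Hilbert bimodule `(B_0, B_1)` and its crossed product -/

/-- The generating set `G_γ`: the non-zero elements of `B_0 ∪ B_1` (note `B_0 ∩ B_1 = {0}`). -/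
def BimodGen (γ : CircleGaugeAction R) : Type u :=
  {b : UnivCStar R // (b ∈ γ.spectral 0 ∨ b ∈ γ.spectral 1) ∧ b ≠ 0}

open Classical in
/-- The generator that corresponds to `b ∈ B_0 ∪ B_1`, where `0 ∈ B_0 ∪ B_1` corresponds to the
zero of the free `*`-algebra. -/
def sym (γ : CircleGaugeAction R) (b : UnivCStar R) : FreeStarAlg γ.BimodGen :=
  if h : (b ∈ γ.spectral 0 ∨ b ∈ γ.spectral 1) ∧ b ≠ 0 then FreeStarAlg.gen ⟨b, h⟩ else 0

/-- The relations `R_γ`: all algebraic relations of the Hilbert bimodule `(B_0, B_1)`, namely the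
linear structures of `B_0` and `B_1`, the product and involution of `B_0`, the two actions of `B_0`
on `B_1`, and the inner products `⟨a, b⟩_R = a^* b` and `_L⟨a, b⟩ = a b^*`. -/
inductive bimodRel (γ : CircleGaugeAction R) : Set (FreeStarAlg γ.BimodGen)
  | add₀ {a b} (ha : a ∈ γ.spectral 0) (hb : b ∈ γ.spectral 0) :
      bimodRel γ (γ.sym (a + b) - (γ.sym a + γ.sym b))
  | add₁ {a b} (ha : a ∈ γ.spectral 1) (hb : b ∈ γ.spectral 1) :
      bimodRel γ (γ.sym (a + b) - (γ.sym a + γ.sym b))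
  | smul₀ (c : ℂ) {a} (ha : a ∈ γ.spectral 0) : bimodRel γ (γ.sym (c • a) - c • γ.sym a)
  | smul₁ (c : ℂ) {a} (ha : a ∈ γ.spectral 1) : bimodRel γ (γ.sym (c • a) - c • γ.sym a)
  | mul {a b} (ha : a ∈ γ.spectral 0) (hb : b ∈ γ.spectral 0) :
      bimodRel γ (γ.sym (a * b) - γ.sym a * γ.sym b)
  | star {a} (ha : a ∈ γ.spectral 0) : bimodRel γ (γ.sym (star a) - star (γ.sym a))
  | left {a b} (ha : a ∈ γ.spectral 0) (hb : b ∈ γ.spectral 1) :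
      bimodRel γ (γ.sym (a * b) - γ.sym a * γ.sym b)
  | right {a b} (ha : a ∈ γ.spectral 1) (hb : b ∈ γ.spectral 0) :
      bimodRel γ (γ.sym (a * b) - γ.sym a * γ.sym b)
  | innerR {a b} (ha : a ∈ γ.spectral 1) (hb : b ∈ γ.spectral 1) :
      bimodRel γ (γ.sym (star a * b) - star (γ.sym a) * γ.sym b)
  | innerL {a b} (ha : a ∈ γ.spectral 1) (hb : b ∈ γ.spectral 1) :
      bimodRel γ (γ.sym (a * star b) - γ.sym a * star (γ.sym b))

/-! ### Admissibility of `(G_γ, R_γ)` -/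

lemma continuous_act (γ : CircleGaugeAction R) (z : Circle) : Continuous (γ.act z) :=
  AddMonoidHomClass.continuous_of_bound (γ.act z) 1 fun x => by
    rw [one_mul]; exact NonUnitalStarAlgHom.norm_apply_le (γ.act z) x

lemma isClosed_spectral (γ : CircleGaugeAction R) (n : ℤ) :
    IsClosed (γ.spectral n : Set (UnivCStar R)) := by
  have : (γ.spectral n : Set (UnivCStar R))
      = ⋂ z : Circle, {b | γ.act z b = ((z : ℂ) ^ n) • b} := by
    ext b; simp [mem_spectral]
  rw [this]
  exact isClosed_iInter fun z => isClosed_eq (γ.continuous_act z) (continuous_const_smul _)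

lemma mem_zero_iff {γ : CircleGaugeAction R} {b : UnivCStar R} :
    b ∈ γ.spectral 0 ↔ ∀ z : Circle, γ.act z b = b := by
  simp [mem_spectral]

/-- The fixed-point algebra `B_0`. -/
def fixedPoint (γ : CircleGaugeAction R) : NonUnitalStarSubalgebra ℂ (UnivCStar R) where
  carrier := γ.spectral 0
  zero_mem' := (γ.spectral 0).zero_mem
  add_mem' := (γ.spectral 0).add_mem
  smul_mem' c _ h := (γ.spectral 0).smul_mem c h
  mul_mem' {a b} ha hb := mem_zero_iff.2 fun z => by
    rw [map_mul, mem_zero_iff.1 ha z, mem_zero_iff.1 hb z]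
  star_mem' {a} ha := mem_zero_iff.2 fun z => by
    rw [map_star, mem_zero_iff.1 ha z]

instance (γ : CircleGaugeAction R) : NonUnitalCStarAlgebra γ.fixedPoint :=
  NonUnitalStarSubalgebra.nonUnitalCStarAlgebra (h_closed := γ.isClosed_spectral 0) γ.fixedPoint

lemma star_mul_mem {γ : CircleGaugeAction R} {a : UnivCStar R} (ha : a ∈ γ.spectral 1) :
    star a * a ∈ γ.spectral 0 := mem_zero_iff.2 fun z => by
  have h : star (z : ℂ) * (z : ℂ) = 1 := by
    rw [mul_comm, ← starRingEnd_apply, Complex.mul_conj, Circle.normSq_coe, Complex.ofReal_one]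
  rw [map_mul, map_star, mem_spectral.1 ha z, zpow_one, star_smul, smul_mul_smul_comm, h,
    one_smul]

/-- A representation of `(G_γ, R_γ)` restricts to a `*`-homomorphism on `B_0`. -/
def restrict {γ : CircleGaugeAction R} (π : Representation γ.bimodRel) :
    γ.fixedPoint →⋆ₙₐ[ℂ] (π.H →L[ℂ] π.H) where
  toFun b := π.eval (γ.sym b)
  map_zero' := by
    have : γ.sym (0 : UnivCStar R) = 0 := by simp [sym]
    rw [ZeroMemClass.coe_zero, this, map_zero]
  map_add' a b := by
    have := π.sat _ (bimodRel.add₀ a.2 b.2)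
    rwa [map_sub, map_add, sub_eq_zero] at this
  map_smul' c a := by
    have := π.sat _ (bimodRel.smul₀ c a.2)
    rwa [map_sub, map_smul, sub_eq_zero] at this
  map_mul' a b := by
    have := π.sat _ (bimodRel.mul a.2 b.2)
    rwa [map_sub, map_mul, sub_eq_zero] at this
  map_star' a := by
    have := π.sat _ (bimodRel.star a.2)
    rwa [map_sub, map_star, sub_eq_zero] at this

lemma norm_sym_le₀ {γ : CircleGaugeAction R} (π : Representation γ.bimodRel) {b : UnivCStar R}
    (hb : b ∈ γ.spectral 0) : ‖π.eval (γ.sym b)‖ ≤ ‖b‖ :=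
  NonUnitalStarAlgHom.norm_apply_le (restrict π) (⟨b, hb⟩ : γ.fixedPoint)

lemma norm_sym_le₁ {γ : CircleGaugeAction R} (π : Representation γ.bimodRel) {b : UnivCStar R}
    (hb : b ∈ γ.spectral 1) : ‖π.eval (γ.sym b)‖ ≤ ‖b‖ := by
  have h := π.sat _ (bimodRel.innerR hb hb)
  rw [map_sub, map_mul, map_star, sub_eq_zero] at h
  have h' := norm_sym_le₀ π (star_mul_mem hb)
  rw [CStarRing.norm_star_mul_self, Representation.eval, h, CStarRing.norm_star_mul_self] at h'
  exact (mul_self_le_mul_self_iff (norm_nonneg _) (norm_nonneg b)).2 h'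

instance (γ : CircleGaugeAction R) : Admissible γ.bimodRel :=
  Admissible.of_bound (fun b => ‖b.1‖) fun π b => by
    have h : π.eval (γ.sym b.1) = π.op b := by
      rw [sym, dif_pos b.2]; exact FreeStarAlg.lift_gen _ _
    rw [← h]
    exact b.2.1.elim (norm_sym_le₀ π) (norm_sym_le₁ π)

/-- The crossed product of `B_0` by the Hilbert bimodule `B_1`: the universal `C^*`-algebra
`C^*(G_γ, R_γ)`. -/
abbrev CrossedProduct (γ : CircleGaugeAction R) : Type u := UnivCStar γ.bimodRel

end CircleGaugeAction

end gauge

end GenRel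

end

/-!
Write `B_n` for the spectral subspaces of `C^*(G, R)` and `D` for the crossed product of `B_0` by
`B_1`. The inclusions of `B_0` and `B_1` satisfy the relations of `D`, and the norm of
`C^*(G, R)` is detected by representations, so there is a canonical map `D → C^*(G, R)`
(`CircleGaugeAction.toUniv`). This map is isometric once it is injective. Its range is then closed,
so it is the `C^*`-algebra generated by `B_0 ∪ B_1`, and surjectivity means that `γ` is
semi-saturated.

Injectivity is a gauge-invariant uniqueness argument. The relations of `D` are homogeneous, so `D`
carries a dual circle action, which the canonical map intertwines with `γ`. The average over the
dual action is faithful (`eq_zero_of_average_eq_zero`). It takes values in the copy of `B_0` in `D`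
(`average_mem`), since by `B_1 B_1^* ⊆ B_0` and `B_1^* B_1 ⊆ B_0` each monomial either
lies in that copy or is homogeneous of non-zero degree (`isNormalForm_wordHom`). If `x` is in the
kernel, so is the average of `x^* x`; but the canonical map is the identity on `B_0`, so this
average vanishes and `x = 0`.

For the uniqueness properties, a direct sum of representations shows that every `C^*(G, R)` has an
injective representation. Hence, if no generator is zero in `C^*(G, R)`, the uniqueness property
says that each faithful representation of `(G, R)` is injective on `C^*(G, R)`
(`uniquenessProperty_iff`). In the semi-saturated case `D` and `C^*(G, R)` are isomorphic, and it
remains to compare faithful representations of the two presentations. A faithful representation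
of `(G_γ, R_γ)` does not vanish on the non-zero elements `g^* g` of `B_0`, so it is faithful on `G`.
A faithful representation of `(G, R)` that is injective on `B_0` does not vanish on `b^* b` for
non-zero `b` in `B_1`, so it is faithful on `G_γ`.
-/

noncomputable section

namespace GenRel

open FreeStarAlg

variable {G : Type u}

/-! ### General facts on `*`-homomorphisms of `C^*`-algebras -/

section starHom

variable {A B : Type*} [NonUnitalCStarAlgebra A] [NonUnitalCStarAlgebra B]

lemma continuous_hom (φ : A →⋆ₙₐ[ℂ] B) : Continuous φ :=
  AddMonoidHomClass.continuous_of_bound φ 1 fun x => by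
    rw [one_mul]; exact NonUnitalStarAlgHom.norm_apply_le φ x

/-- A `*`-homomorphism of `C^*`-algebras as a continuous linear map. -/
def homCLM (φ : A →⋆ₙₐ[ℂ] B) : A →L[ℂ] B where
  toFun := φ
  map_add' := map_add φ
  map_smul' := map_smul φ
  cont := continuous_hom φ

lemma homCLM_apply (φ : A →⋆ₙₐ[ℂ] B) (a : A) : homCLM φ a = φ a := rfl

lemma isClosed_range_of_injective {φ : A →⋆ₙₐ[ℂ] B} (hφ : Function.Injective φ) :
    IsClosed (Set.range φ) :=
  (NonUnitalStarAlgHom.isometry φ hφ).isClosedEmbedding.isClosed_range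

end starHom

/-! ### Homomorphisms out of the universal `C^*`-algebra -/

namespace UnivCStar

variable {R : Set (FreeStarAlg G)} [hR : Admissible R]

lemma ofHom_gen (g : G) : ofHom R (FreeStarAlg.gen g) = gen R g := rfl

lemma ofₗᵢ_eq_ofHom (w : PreUniv R) : ofₗᵢ R w = ofHom R (PreUniv.toFree R w) := rfl

/-- To prove a closed property on `C^*(G, R)`, it suffices to prove it on the image of the free
`*`-algebra. -/
@[elab_as_elim]
lemma induction_ofHom {p : UnivCStar R → Prop} (x : UnivCStar R) (hp : IsClosed {x | p x})
    (ih : ∀ w, p (ofHom R w)) : p x :=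
  induction_on x hp fun w => ih (PreUniv.toFree R w)

lemma hom_ext {A : Type*} [NonUnitalCStarAlgebra A] {φ ψ : UnivCStar R →⋆ₙₐ[ℂ] A}
    (h : ∀ g, φ (gen R g) = ψ (gen R g)) : φ = ψ := by
  have h' : φ.comp (ofHom R) = ψ.comp (ofHom R) := FreeStarAlg.hom_ext h
  refine NonUnitalStarAlgHom.ext fun x => ?_
  induction x using induction_ofHom with
  | hp => exact isClosed_eq (continuous_hom φ) (continuous_hom ψ)
  | ih w => exact DFunLike.congr_fun h' w

lemma ext_ofHom (π : Representation R) (w : FreeStarAlg G) : π.ext (ofHom R w) = π.eval w :=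
  extend_of π.eval (norm_eval_le π) w

lemma ext_gen (π : Representation R) (g : G) : π.ext (gen R g) = π.op g := by
  rw [← ofHom_gen, ext_ofHom, Representation.eval, lift_gen]

/-- The norm of `C^*(G, R)` is the supremum of the norms in all representations. -/
lemma norm_le_of_ext_le {x : UnivCStar R} {c : ℝ} (h : ∀ π : Representation R, ‖π.ext x‖ ≤ c) :
    ‖x‖ ≤ c := by
  refine le_of_forall_pos_le_add fun ε hε => ?_
  obtain ⟨w, hw⟩ := (isDenseInducing_of R).dense.exists_dist_lt x (half_pos (half_pos hε))
  rw [ofₗᵢ_eq_ofHom, dist_eq_norm] at hw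
  set v := PreUniv.toFree R w
  obtain ⟨π, hπ⟩ := exists_lt_of_lt_ciSup
    (show univNorm R v - ε / 2 < ⨆ π : Representation R, ‖π.eval v‖ from
      sub_lt_self _ (half_pos hε))
  have h₁ : ‖x‖ ≤ ‖x - ofHom R v‖ + univNorm R v := by
    rw [← norm_ofHom]; simpa using norm_add_le (x - ofHom R v) (ofHom R v)
  have h₂ : ‖π.eval v‖ ≤ ‖π.ext x‖ + ‖x - ofHom R v‖ := by
    have h₃ := NonUnitalStarAlgHom.norm_apply_le π.ext (x - ofHom R v)
    have h₄ := norm_sub_le (π.ext x) (π.ext (x - ofHom R v))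
    rw [← map_sub, sub_sub_cancel, ext_ofHom] at h₄
    linarith
  linarith [h π]

lemma eq_zero_of_ext {x : UnivCStar R} (h : ∀ π : Representation R, π.ext x = 0) : x = 0 :=
  norm_le_zero_iff.1 (norm_le_of_ext_le fun π => by rw [h π, norm_zero])

/-- A `*`-homomorphism from `C^*(G, R)` to operators restricts to a representation of `(G, R)`. -/
def toRepresentation {H : Type u} [NormedAddCommGroup H] [InnerProductSpace ℂ H] [CompleteSpace H]
    (ψ : UnivCStar R →⋆ₙₐ[ℂ] (H →L[ℂ] H)) : Representation R where
  H := H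
  op g := ψ (gen R g)
  sat r hr := by
    have h : FreeStarAlg.lift (fun g => ψ (gen R g)) = ψ.comp (ofHom R) :=
      FreeStarAlg.hom_ext fun g => by rw [lift_gen]; rfl
    have h0 : ofHom R r = 0 := by
      rw [← norm_eq_zero, norm_ofHom]; exact mem_nullIdeal_of_mem hr
    rw [h, NonUnitalStarAlgHom.comp_apply, h0, map_zero]

lemma ext_toRepresentation {H : Type u} [NormedAddCommGroup H] [InnerProductSpace ℂ H]
    [CompleteSpace H] (ψ : UnivCStar R →⋆ₙₐ[ℂ] (H →L[ℂ] H)) : (toRepresentation ψ).ext = ψ :=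
  hom_ext fun g => ext_gen _ g

section liftRel

variable {G' : Type u} {S : Set (FreeStarAlg G')} [Admissible S]

/-- A family in `C^*(G', S)` that satisfies the relations `R` is dominated by `|||·|||`: each
representation of `(G', S)` turns it into a representation of `(G, R)`. -/
lemma norm_lift_le (f : G → UnivCStar S) (hf : ∀ r ∈ R, FreeStarAlg.lift f r = 0)
    (w : FreeStarAlg G) : ‖FreeStarAlg.lift f w‖ ≤ univNorm R w :=
  norm_le_of_ext_le fun π => by
    have h : FreeStarAlg.lift (fun g => π.ext (f g)) = π.ext.comp (FreeStarAlg.lift f) :=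
      FreeStarAlg.hom_ext fun g => by
        rw [lift_gen, NonUnitalStarAlgHom.comp_apply, lift_gen]
    let ρ : Representation R :=
      { H := π.H
        op := fun g => π.ext (f g)
        sat := fun r hr => by rw [h, NonUnitalStarAlgHom.comp_apply, hf r hr, map_zero] }
    calc ‖π.ext (FreeStarAlg.lift f w)‖ = ‖ρ.eval w‖ :=
          congrArg norm (DFunLike.congr_fun h w).symm
      _ ≤ univNorm R w := norm_eval_le ρ w

/-- The universal property of `C^*(G, R)` with respect to universal `C^*`-algebras. -/
def liftRel (f : G → UnivCStar S) (hf : ∀ r ∈ R, FreeStarAlg.lift f r = 0) :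
    UnivCStar R →⋆ₙₐ[ℂ] UnivCStar S :=
  extend (FreeStarAlg.lift f) (norm_lift_le f hf)

lemma liftRel_ofHom (f : G → UnivCStar S) (hf : ∀ r ∈ R, FreeStarAlg.lift f r = 0)
    (w : FreeStarAlg G) : liftRel f hf (ofHom R w) = FreeStarAlg.lift f w :=
  extend_of _ (norm_lift_le f hf) w

lemma liftRel_gen (f : G → UnivCStar S) (hf : ∀ r ∈ R, FreeStarAlg.lift f r = 0) (g : G) :
    liftRel f hf (gen R g) = f g := by
  rw [← ofHom_gen, liftRel_ofHom, lift_gen]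

end liftRel

end UnivCStar

/-! ### Direct sums of representations -/

section directSum

open scoped lp ENNReal InnerProductSpace

variable {A : Type*} [NonUnitalCStarAlgebra A] {ι : Type*} {H : ι → Type*}
  [∀ i, NormedAddCommGroup (H i)] [∀ i, InnerProductSpace ℂ (H i)] [∀ i, CompleteSpace (H i)]

/-- The diagonal operator `⊕ ψ_i(a)` on the Hilbert sum of the `H_i`. -/
def directSumOp (ψ : ∀ i, A →⋆ₙₐ[ℂ] (H i →L[ℂ] H i)) (a : A) : lp H 2 →L[ℂ] lp H 2 :=
  lp.mapCLM 2 (fun i => ψ i a) (norm_nonneg a) fun i => NonUnitalStarAlgHom.norm_apply_le (ψ i) a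

lemma directSumOp_apply (ψ : ∀ i, A →⋆ₙₐ[ℂ] (H i →L[ℂ] H i)) (a : A) (x : lp H 2) (i : ι) :
    directSumOp ψ a x i = ψ i a (x i) := rfl

/-- The direct sum of a family of representations of a `C^*`-algebra. -/
def directSum (ψ : ∀ i, A →⋆ₙₐ[ℂ] (H i →L[ℂ] H i)) : A →⋆ₙₐ[ℂ] (lp H 2 →L[ℂ] lp H 2) where
  toFun := directSumOp ψ
  map_zero' := by ext x i; simp [directSumOp_apply]
  map_add' a b := by ext x i; simp [directSumOp_apply]
  map_smul' c a := by ext x i; simp [directSumOp_apply]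
  map_mul' a b := by ext x i; simp [directSumOp_apply]
  map_star' a := by
    refine (ContinuousLinearMap.eq_adjoint_iff _ _).2 fun x y => ?_
    rw [lp.inner_eq_tsum, lp.inner_eq_tsum]
    refine tsum_congr fun i => ?_
    rw [directSumOp_apply, directSumOp_apply, map_star, ContinuousLinearMap.star_eq_adjoint,
      ContinuousLinearMap.adjoint_inner_left]

lemma directSum_apply (ψ : ∀ i, A →⋆ₙₐ[ℂ] (H i →L[ℂ] H i)) (a : A) (x : lp H 2) (i : ι) :
    directSum ψ a x i = ψ i a (x i) := rfl

lemma eq_zero_of_directSum_eq_zero (ψ : ∀ i, A →⋆ₙₐ[ℂ] (H i →L[ℂ] H i)) {a : A}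
    (h : directSum ψ a = 0) (i : ι) : ψ i a = 0 := by
  classical
  ext ξ
  have := directSum_apply ψ a (lp.single 2 i ξ) i
  rw [h] at this
  simpa using this.symm

end directSum

/-! ### The uniqueness property and injectivity on `C^*(G, R)` -/

namespace Representation

variable {R : Set (FreeStarAlg G)} [hR : Admissible R]

/-- The direct sum, over the non-zero `x ∈ C^*(G, R)`, of representations that do not vanish
on `x`. -/
lemma exists_injective_ext (R : Set (FreeStarAlg G)) [Admissible R] :
    ∃ π : Representation R, Function.Injective π.ext := by
  have h : ∀ x : {x : UnivCStar R // x ≠ 0}, ∃ π : Representation R, π.ext x.1 ≠ 0 := fun x => by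
    by_contra! h
    exact x.2 (UnivCStar.eq_zero_of_ext h)
  choose π hπ using h
  refine ⟨UnivCStar.toRepresentation (directSum fun x => (π x).ext), ?_⟩
  have hinj : Function.Injective (directSum fun x => (π x).ext) := by
    rw [injective_iff_map_eq_zero]
    intro x hx
    by_contra hne
    exact hπ ⟨x, hne⟩ (eq_zero_of_directSum_eq_zero _ hx ⟨x, hne⟩)
  rw [UnivCStar.ext_toRepresentation]
  exact hinj

lemma faithful_of_injective_ext {π : Representation R} (hπ : Function.Injective π.ext)
    (hg : ∀ g, UnivCStar.gen R g ≠ 0) : π.Faithful := fun g h =>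
  hg g (hπ (by rw [UnivCStar.ext_gen, h, map_zero]))

lemma Faithful.gen_ne_zero {π : Representation R} (hπ : π.Faithful) (g : G) :
    UnivCStar.gen R g ≠ 0 := fun h => hπ g (by rw [← UnivCStar.ext_gen, h, map_zero])

lemma ext_mem_cstar (π : Representation R) (x : UnivCStar R) : π.ext x ∈ π.cstar := by
  induction x using UnivCStar.induction_ofHom with
  | hp =>
    exact (NonUnitalStarSubalgebra.isClosed_topologicalClosure _).preimage
      (continuous_hom π.ext)
  | ih w =>
    refine NonUnitalStarSubalgebra.le_topologicalClosure _ ?_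
    rw [UnivCStar.ext_ofHom]
    have hw : ∀ v : Word G, wordHom π.op v ∈ NonUnitalStarAlgebra.adjoin ℂ (Set.range π.op) := by
      intro v
      induction v using FreeSemigroup.recOnMul with
      | ih1 p =>
        rcases p with ⟨g, _ | _⟩
        · exact NonUnitalStarAlgebra.subset_adjoin ℂ _ ⟨g, rfl⟩
        · exact star_mem (NonUnitalStarAlgebra.subset_adjoin ℂ (Set.range π.op) ⟨g, rfl⟩)
      | ih2 p v hp hv => rw [map_mul]; exact mul_mem hp hv
    induction w using induction_mono with
    | zero => rw [map_zero]; exact zero_mem _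
    | add x y hx hy => rw [map_add]; exact add_mem hx hy
    | mono v c => rw [eval, lift_mono]; exact SMulMemClass.smul_mem c (hw v)

/-- The extension of `π` as a `*`-homomorphism onto `C^*(π)`. -/
def extCstar (π : Representation R) : UnivCStar R →⋆ₙₐ[ℂ] π.cstar :=
  NonUnitalStarAlgHom.codRestrict π.ext π.cstar π.ext_mem_cstar

lemma extCstar_bijective {π : Representation R} (hπ : Function.Injective π.ext) :
    Function.Bijective π.extCstar := by
  refine ⟨fun x y h => hπ (congrArg Subtype.val h), fun ⟨y, hy⟩ => ?_⟩
  have hle : NonUnitalStarAlgebra.adjoin ℂ (Set.range π.op) ≤ NonUnitalStarAlgHom.range π.ext :=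
    NonUnitalStarAlgebra.adjoin_le (by
      rintro _ ⟨g, rfl⟩
      exact ⟨UnivCStar.gen R g, UnivCStar.ext_gen π g⟩)
  obtain ⟨x, hx⟩ := closure_minimal (s := (NonUnitalStarAlgebra.adjoin ℂ (Set.range π.op) : Set _))
    hle (isClosed_range_of_injective hπ) hy
  exact ⟨x, Subtype.ext hx⟩

end Representation

/-- For a non-degenerate pair, the uniqueness property says that every faithful representation
extends to an injective one of `C^*(G, R)`. -/
lemma uniquenessProperty_iff {R : Set (FreeStarAlg G)} [Admissible R]
    (hg : ∀ g, UnivCStar.gen R g ≠ 0) :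
    UniquenessProperty R ↔ ∀ π : Representation R, π.Faithful → Function.Injective π.ext := by
  constructor
  · intro h π hπ
    obtain ⟨ρ, hρ⟩ := Representation.exists_injective_ext R
    obtain ⟨e, he⟩ := h ρ π (Representation.faithful_of_injective_ext hρ hg) hπ
    -- `e` intertwines the two representations of `C^*(G, R)`, as it does so on generators.
    have key : ∀ x, (e (ρ.extCstar x) : π.H →L[ℂ] π.H) = π.ext x := by
      let ψ : UnivCStar R →⋆ₙₐ[ℂ] (π.H →L[ℂ] π.H) :=
        ((NonUnitalStarSubalgebraClass.subtype π.cstar).comp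
          (e : ρ.cstar →⋆ₙₐ[ℂ] π.cstar)).comp ρ.extCstar
      have : ψ = π.ext := UnivCStar.hom_ext fun g => by
        change (e (ρ.extCstar (UnivCStar.gen R g)) : π.H →L[ℂ] π.H) = _
        have h1 : ρ.extCstar (UnivCStar.gen R g) = ⟨ρ.op g, ρ.op_mem_cstar g⟩ :=
          Subtype.ext (UnivCStar.ext_gen ρ g)
        rw [h1, he, UnivCStar.ext_gen]
      exact fun x => DFunLike.congr_fun this x
    intro x y hxy
    rw [← key, ← key] at hxy
    exact (Representation.extCstar_bijective hρ).1 (e.injective (Subtype.ext hxy))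
  · intro h π₁ π₂ h₁ h₂
    let e₁ := StarAlgEquiv.ofBijective π₁.extCstar (Representation.extCstar_bijective (h π₁ h₁))
    let e₂ := StarAlgEquiv.ofBijective π₂.extCstar (Representation.extCstar_bijective (h π₂ h₂))
    refine ⟨e₁.symm.trans e₂, fun g => ?_⟩
    have h1 : e₁ (UnivCStar.gen R g) = ⟨π₁.op g, π₁.op_mem_cstar g⟩ :=
      Subtype.ext (UnivCStar.ext_gen π₁ g)
    have h2 : e₂ (UnivCStar.gen R g) = ⟨π₂.op g, π₂.op_mem_cstar g⟩ :=
      Subtype.ext (UnivCStar.ext_gen π₂ g)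
    rw [← h1, StarAlgEquiv.trans_apply, StarAlgEquiv.symm_apply_apply, h2]

namespace CircleGaugeAction

variable {R : Set (FreeStarAlg G)} [hR : Admissible R]

/-! ### The grading of `C^*(G, R)` by spectral subspaces -/

lemma star_coe_mul_coe (z : Circle) : star (z : ℂ) * (z : ℂ) = 1 := by
  rw [mul_comm, ← starRingEnd_apply, Complex.mul_conj, Circle.normSq_coe, Complex.ofReal_one]

lemma star_coe_zpow (z : Circle) (n : ℤ) : star ((z : ℂ) ^ n) = (z : ℂ) ^ (-n) := by
  rw [star_zpow₀, zpow_neg, ← inv_zpow]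
  congr 1
  exact eq_inv_of_mul_eq_one_left (star_coe_mul_coe z)

lemma mul_mem_spectral {γ : CircleGaugeAction R} {k m n : ℤ} (h : m + n = k) {a b : UnivCStar R}
    (ha : a ∈ γ.spectral m) (hb : b ∈ γ.spectral n) : a * b ∈ γ.spectral k := fun z => by
  rw [map_mul, ha z, hb z, smul_mul_smul_comm, ← zpow_add₀ z.coe_ne_zero, h]

lemma star_mem_spectral {γ : CircleGaugeAction R} {m n : ℤ} (h : -m = n) {a : UnivCStar R}
    (ha : a ∈ γ.spectral m) : star a ∈ γ.spectral n := fun z => by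
  rw [map_star, ha z, star_smul, star_coe_zpow, h]

section

variable {γ : CircleGaugeAction R} {a b : UnivCStar R}

lemma mul_mem₀₀ (ha : a ∈ γ.spectral 0) (hb : b ∈ γ.spectral 0) : a * b ∈ γ.spectral 0 :=
  mul_mem_spectral (zero_add 0) ha hb

lemma mul_mem₀₁ (ha : a ∈ γ.spectral 0) (hb : b ∈ γ.spectral 1) : a * b ∈ γ.spectral 1 :=
  mul_mem_spectral (zero_add 1) ha hb

lemma mul_mem₁₀ (ha : a ∈ γ.spectral 1) (hb : b ∈ γ.spectral 0) : a * b ∈ γ.spectral 1 :=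
  mul_mem_spectral (add_zero 1) ha hb

lemma star_mem₀ (ha : a ∈ γ.spectral 0) : star a ∈ γ.spectral 0 :=
  star_mem_spectral neg_zero ha

lemma star_mul_mem₁₁ (ha : a ∈ γ.spectral 1) (hb : b ∈ γ.spectral 1) :
    star a * b ∈ γ.spectral 0 :=
  mul_mem_spectral (neg_add_cancel 1) (star_mem_spectral rfl ha) hb

lemma mul_star_mem₁₁ (ha : a ∈ γ.spectral 1) (hb : b ∈ γ.spectral 1) :
    a * star b ∈ γ.spectral 0 :=
  mul_mem_spectral (add_neg_cancel 1) ha (star_mem_spectral rfl hb)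

end

lemma eq_zero_of_mem_spectral {γ : CircleGaugeAction R} {b : UnivCStar R}
    (h₀ : b ∈ γ.spectral 0) (h₁ : b ∈ γ.spectral 1) : b = 0 := by
  have h : b = -b := by
    -- `γ` acts on `b` at `-1 = exp(iπ)` both trivially and by the sign.
    have h := (mem_zero_iff.1 h₀ (Circle.exp Real.pi)).symm.trans (h₁ (Circle.exp Real.pi))
    simpa using h
  have h2 : (2 : ℂ) • b = 0 := by rw [two_smul]; nth_rw 2 [h]; exact add_neg_cancel b
  exact (smul_eq_zero.1 h2).resolve_left two_ne_zero

variable (γ : CircleGaugeAction R)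

lemma star_gen_mul_gen_mem (g : G) :
    star (UnivCStar.gen R g) * UnivCStar.gen R g ∈ γ.spectral 0 := mem_zero_iff.2 fun z => by
  rw [map_mul, map_star, act_gen, star_smul, smul_mul_smul_comm, star_coe_mul_coe, one_smul]

/-! ### The canonical copies of `B_0` and `B_1` in the crossed product -/

lemma sym_zero : γ.sym (0 : UnivCStar R) = 0 := by simp [sym]

/-- The element of the crossed product that corresponds to `b ∈ B_0 ∪ B_1`. -/
def emb (b : UnivCStar R) : γ.CrossedProduct := UnivCStar.ofHom γ.bimodRel (γ.sym b)

variable {γ}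

lemma ofHom_rel {r : FreeStarAlg γ.BimodGen} (hr : r ∈ γ.bimodRel) :
    UnivCStar.ofHom γ.bimodRel r = 0 := by
  rw [← norm_eq_zero, UnivCStar.norm_ofHom]; exact mem_nullIdeal_of_mem hr

lemma sym_coe (b : γ.BimodGen) : γ.sym b.1 = FreeStarAlg.gen b := dif_pos b.2

lemma emb_coe (b : γ.BimodGen) : γ.emb b.1 = UnivCStar.gen γ.bimodRel b := by
  rw [emb, sym_coe, UnivCStar.ofHom_gen]

variable (γ) in
@[simp] lemma emb_zero : γ.emb 0 = 0 := by rw [emb, sym_zero, map_zero]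

lemma emb_add₀ {a b : UnivCStar R} (ha : a ∈ γ.spectral 0) (hb : b ∈ γ.spectral 0) :
    γ.emb (a + b) = γ.emb a + γ.emb b := by
  simpa only [map_sub, map_add, sub_eq_zero, emb] using ofHom_rel (bimodRel.add₀ ha hb)

lemma emb_add₁ {a b : UnivCStar R} (ha : a ∈ γ.spectral 1) (hb : b ∈ γ.spectral 1) :
    γ.emb (a + b) = γ.emb a + γ.emb b := by
  simpa only [map_sub, map_add, sub_eq_zero, emb] using ofHom_rel (bimodRel.add₁ ha hb)

lemma emb_smul₀ (c : ℂ) {a : UnivCStar R} (ha : a ∈ γ.spectral 0) :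
    γ.emb (c • a) = c • γ.emb a := by
  simpa only [map_sub, map_smul, sub_eq_zero, emb] using ofHom_rel (bimodRel.smul₀ c ha)

lemma emb_smul₁ (c : ℂ) {a : UnivCStar R} (ha : a ∈ γ.spectral 1) :
    γ.emb (c • a) = c • γ.emb a := by
  simpa only [map_sub, map_smul, sub_eq_zero, emb] using ofHom_rel (bimodRel.smul₁ c ha)

lemma emb_mul {a b : UnivCStar R} (ha : a ∈ γ.spectral 0) (hb : b ∈ γ.spectral 0) :
    γ.emb (a * b) = γ.emb a * γ.emb b := by
  simpa only [map_sub, map_mul, sub_eq_zero, emb] using ofHom_rel (bimodRel.mul ha hb)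

lemma emb_star {a : UnivCStar R} (ha : a ∈ γ.spectral 0) :
    γ.emb (star a) = star (γ.emb a) := by
  simpa only [map_sub, map_star, sub_eq_zero, emb] using ofHom_rel (bimodRel.star ha)

lemma emb_left {a b : UnivCStar R} (ha : a ∈ γ.spectral 0) (hb : b ∈ γ.spectral 1) :
    γ.emb (a * b) = γ.emb a * γ.emb b := by
  simpa only [map_sub, map_mul, sub_eq_zero, emb] using ofHom_rel (bimodRel.left ha hb)

lemma emb_right {a b : UnivCStar R} (ha : a ∈ γ.spectral 1) (hb : b ∈ γ.spectral 0) :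
    γ.emb (a * b) = γ.emb a * γ.emb b := by
  simpa only [map_sub, map_mul, sub_eq_zero, emb] using ofHom_rel (bimodRel.right ha hb)

lemma emb_innerR {a b : UnivCStar R} (ha : a ∈ γ.spectral 1) (hb : b ∈ γ.spectral 1) :
    γ.emb (star a * b) = star (γ.emb a) * γ.emb b := by
  simpa only [map_sub, map_mul, map_star, sub_eq_zero, emb] using ofHom_rel (bimodRel.innerR ha hb)

lemma emb_innerL {a b : UnivCStar R} (ha : a ∈ γ.spectral 1) (hb : b ∈ γ.spectral 1) :
    γ.emb (a * star b) = γ.emb a * star (γ.emb b) := by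
  simpa only [map_sub, map_mul, map_star, sub_eq_zero, emb] using ofHom_rel (bimodRel.innerL ha hb)

/-! ### The canonical homomorphism into `C^*(G, R)` -/

variable (γ) in
lemma lift_val_sym {b : UnivCStar R} (hb : b ∈ γ.spectral 0 ∨ b ∈ γ.spectral 1) :
    FreeStarAlg.lift (fun b : γ.BimodGen => b.1) (γ.sym b) = b := by
  by_cases h : b = 0
  · rw [h, sym_zero, map_zero]
  · exact (congrArg _ (sym_coe ⟨b, hb, h⟩)).trans (lift_gen _ _)

variable (γ) in
lemma lift_val_rel : ∀ r ∈ γ.bimodRel, FreeStarAlg.lift (fun b : γ.BimodGen => b.1) r = 0 := by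
  have h₀ {b : UnivCStar R} (hb : b ∈ γ.spectral 0) := γ.lift_val_sym (.inl hb)
  have h₁ {b : UnivCStar R} (hb : b ∈ γ.spectral 1) := γ.lift_val_sym (.inr hb)
  rintro r (⟨ha, hb⟩ | ⟨ha, hb⟩ | ⟨c, ha⟩ | ⟨c, ha⟩ | ⟨ha, hb⟩ | ha | ⟨ha, hb⟩ | ⟨ha, hb⟩ |
    ⟨ha, hb⟩ | ⟨ha, hb⟩)
  · rw [map_sub, map_add, h₀ ha, h₀ hb, h₀ (add_mem ha hb), sub_self]
  · rw [map_sub, map_add, h₁ ha, h₁ hb, h₁ (add_mem ha hb), sub_self]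
  · rw [map_sub, map_smul, h₀ ha, h₀ (Submodule.smul_mem _ c ha), sub_self]
  · rw [map_sub, map_smul, h₁ ha, h₁ (Submodule.smul_mem _ c ha), sub_self]
  · rw [map_sub, map_mul, h₀ ha, h₀ hb, h₀ (mul_mem₀₀ ha hb), sub_self]
  · rw [map_sub, map_star, h₀ ha, h₀ (star_mem₀ ha), sub_self]
  · rw [map_sub, map_mul, h₀ ha, h₁ hb, h₁ (mul_mem₀₁ ha hb), sub_self]
  · rw [map_sub, map_mul, h₁ ha, h₀ hb, h₁ (mul_mem₁₀ ha hb), sub_self]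
  · rw [map_sub, map_mul, map_star, h₁ ha, h₁ hb,
      h₀ (star_mul_mem₁₁ ha hb), sub_self]
  · rw [map_sub, map_mul, map_star, h₁ ha, h₁ hb,
      h₀ (mul_star_mem₁₁ ha hb), sub_self]

variable (γ) in
/-- The `*`-homomorphism `B_1 ⋊ ℤ → C^*(G, R)` that sends the generator corresponding to `b`
to `b`. -/
def toUniv : γ.CrossedProduct →⋆ₙₐ[ℂ] UnivCStar R :=
  UnivCStar.liftRel (fun b : γ.BimodGen => b.1) γ.lift_val_rel

variable (γ) in
lemma toUniv_gen (b : γ.BimodGen) : γ.toUniv (UnivCStar.gen γ.bimodRel b) = b.1 :=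
  UnivCStar.liftRel_gen _ γ.lift_val_rel b

lemma toUniv_emb {b : UnivCStar R} (hb : b ∈ γ.spectral 0 ∨ b ∈ γ.spectral 1) :
    γ.toUniv (γ.emb b) = b := by
  rw [toUniv, emb, UnivCStar.liftRel_ofHom, γ.lift_val_sym hb]

variable (γ) in
/-- The inclusion of the fixed-point algebra `B_0` into the crossed product. -/
def embFixed : γ.fixedPoint →⋆ₙₐ[ℂ] γ.CrossedProduct where
  toFun b := γ.emb b
  map_zero' := γ.emb_zero
  map_add' a b := emb_add₀ a.2 b.2
  map_smul' c a := emb_smul₀ c a.2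
  map_mul' a b := emb_mul a.2 b.2
  map_star' a := emb_star a.2

lemma embFixed_apply (b : γ.fixedPoint) : γ.embFixed b = γ.emb b := rfl

lemma embFixed_injective : Function.Injective γ.embFixed := fun a b h => Subtype.ext <| by
  rw [← toUniv_emb (γ := γ) (.inl a.2), ← toUniv_emb (γ := γ) (.inl b.2)]
  exact congrArg γ.toUniv h

lemma isClosed_range_embFixed : IsClosed (Set.range γ.embFixed) :=
  isClosed_range_of_injective embFixed_injective

/-! ### The dual action on the crossed product -/

open Classical in
variable (γ) in
/-- The images of the generators under the dual action: elements of `B_0` are fixed, elements of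
`B_1` are multiplied by `z`. -/
def dualGen (z : Circle) (b : γ.BimodGen) : γ.CrossedProduct :=
  if b.1 ∈ γ.spectral 0 then UnivCStar.gen γ.bimodRel b
  else (z : ℂ) • UnivCStar.gen γ.bimodRel b

lemma dualGen_of_mem₀ (z : Circle) {b : γ.BimodGen} (hb : b.1 ∈ γ.spectral 0) :
    γ.dualGen z b = γ.emb b.1 := by
  rw [dualGen, if_pos hb, emb_coe]

lemma dualGen_of_mem₁ (z : Circle) {b : γ.BimodGen} (hb : b.1 ∈ γ.spectral 1) :
    γ.dualGen z b = (z : ℂ) • γ.emb b.1 := by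
  rw [dualGen, if_neg fun h₀ => b.2.2 (eq_zero_of_mem_spectral h₀ hb), emb_coe]

lemma lift_dualGen_sym₀ (z : Circle) {b : UnivCStar R} (hb : b ∈ γ.spectral 0) :
    FreeStarAlg.lift (γ.dualGen z) (γ.sym b) = γ.emb b := by
  by_cases h : b = 0
  · rw [h, sym_zero, map_zero, emb_zero]
  · exact (congrArg _ (sym_coe ⟨b, .inl hb, h⟩)).trans
      ((lift_gen _ _).trans (dualGen_of_mem₀ z (b := ⟨b, .inl hb, h⟩) hb))

lemma lift_dualGen_sym₁ (z : Circle) {b : UnivCStar R} (hb : b ∈ γ.spectral 1) :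
    FreeStarAlg.lift (γ.dualGen z) (γ.sym b) = (z : ℂ) • γ.emb b := by
  by_cases h : b = 0
  · rw [h, sym_zero, map_zero, emb_zero, smul_zero]
  · exact (congrArg _ (sym_coe ⟨b, .inr hb, h⟩)).trans
      ((lift_gen _ _).trans (dualGen_of_mem₁ z (b := ⟨b, .inr hb, h⟩) hb))

variable (γ) in
/-- The relations are homogeneous if elements of `B_0` and of `B_1` have degree `0` and `1`. -/
lemma lift_dualGen_rel (z : Circle) :
    ∀ r ∈ γ.bimodRel, FreeStarAlg.lift (γ.dualGen z) r = 0 := by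
  have h₀ {b : UnivCStar R} (hb : b ∈ γ.spectral 0) := lift_dualGen_sym₀ z hb
  have h₁ {b : UnivCStar R} (hb : b ∈ γ.spectral 1) := lift_dualGen_sym₁ z hb
  rintro r (⟨ha, hb⟩ | ⟨ha, hb⟩ | ⟨c, ha⟩ | ⟨c, ha⟩ | ⟨ha, hb⟩ | ha | ⟨ha, hb⟩ | ⟨ha, hb⟩ |
    ⟨ha, hb⟩ | ⟨ha, hb⟩)
  · rw [map_sub, map_add, h₀ ha, h₀ hb, h₀ (add_mem ha hb), emb_add₀ ha hb, sub_self]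
  · rw [map_sub, map_add, h₁ ha, h₁ hb, h₁ (add_mem ha hb), emb_add₁ ha hb, smul_add, sub_self]
  · rw [map_sub, map_smul, h₀ ha, h₀ (Submodule.smul_mem _ c ha), emb_smul₀ c ha, sub_self]
  · rw [map_sub, map_smul, h₁ ha, h₁ (Submodule.smul_mem _ c ha), emb_smul₁ c ha, smul_comm,
      sub_self]
  · rw [map_sub, map_mul, h₀ ha, h₀ hb, h₀ (mul_mem₀₀ ha hb), emb_mul ha hb, sub_self]
  · rw [map_sub, map_star, h₀ ha, h₀ (star_mem₀ ha), emb_star ha, sub_self]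
  · rw [map_sub, map_mul, h₀ ha, h₁ hb, h₁ (mul_mem₀₁ ha hb), emb_left ha hb,
      mul_smul_comm, sub_self]
  · rw [map_sub, map_mul, h₁ ha, h₀ hb, h₁ (mul_mem₁₀ ha hb), emb_right ha hb,
      smul_mul_assoc, sub_self]
  · rw [map_sub, map_mul, map_star, h₁ ha, h₁ hb,
      h₀ (star_mul_mem₁₁ ha hb), emb_innerR ha hb, star_smul,
      smul_mul_smul_comm, star_coe_mul_coe, one_smul, sub_self]
  · rw [map_sub, map_mul, map_star, h₁ ha, h₁ hb,
      h₀ (mul_star_mem₁₁ ha hb), emb_innerL ha hb, star_smul,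
      smul_mul_smul_comm, mul_comm, star_coe_mul_coe, one_smul, sub_self]

variable (γ) in
/-- The dual action of the circle on the crossed product. -/
def dualAct (z : Circle) : γ.CrossedProduct →⋆ₙₐ[ℂ] γ.CrossedProduct :=
  UnivCStar.liftRel (γ.dualGen z) (γ.lift_dualGen_rel z)

lemma dualAct_emb₀ (z : Circle) {b : UnivCStar R} (hb : b ∈ γ.spectral 0) :
    γ.dualAct z (γ.emb b) = γ.emb b := by
  rw [dualAct, emb, UnivCStar.liftRel_ofHom, lift_dualGen_sym₀ z hb, emb]

lemma dualAct_emb₁ (z : Circle) {b : UnivCStar R} (hb : b ∈ γ.spectral 1) :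
    γ.dualAct z (γ.emb b) = (z : ℂ) • γ.emb b := by
  rw [dualAct, emb, UnivCStar.liftRel_ofHom, lift_dualGen_sym₁ z hb, emb]

variable (γ) in
lemma dualAct_one : γ.dualAct 1 = NonUnitalStarAlgHom.id ℂ γ.CrossedProduct :=
  UnivCStar.hom_ext fun b => by
    rw [← emb_coe]
    rcases b.2.1 with hb | hb
    · rw [dualAct_emb₀ 1 hb]; rfl
    · rw [dualAct_emb₁ 1 hb, Circle.coe_one, one_smul]; rfl

lemma toUniv_dualAct (z : Circle) (x : γ.CrossedProduct) :
    γ.toUniv (γ.dualAct z x) = γ.act z (γ.toUniv x) := by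
  have h : γ.toUniv.comp (γ.dualAct z) = (γ.act z).comp γ.toUniv :=
    UnivCStar.hom_ext fun b => by
      rw [NonUnitalStarAlgHom.comp_apply, NonUnitalStarAlgHom.comp_apply, ← emb_coe,
        toUniv_emb b.2.1]
      rcases b.2.1 with hb | hb
      · rw [dualAct_emb₀ z hb, toUniv_emb b.2.1, mem_zero_iff.1 hb]
      · rw [dualAct_emb₁ z hb, map_smul, toUniv_emb b.2.1, mem_spectral.1 hb z, zpow_one]
  exact DFunLike.congr_fun h x

lemma continuous_dualAct_ofHom (w : FreeStarAlg γ.BimodGen) :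
    Continuous fun z => γ.dualAct z (UnivCStar.ofHom γ.bimodRel w) := by
  simp only [dualAct, UnivCStar.liftRel_ofHom]
  have hgen : ∀ b, Continuous fun z => γ.dualGen z b := fun b => by
    unfold dualGen
    split_ifs
    · exact continuous_const
    · exact (by fun_prop : Continuous fun z : Circle => (z : ℂ)).smul continuous_const
  have hw : ∀ v : Word γ.BimodGen, Continuous fun z => wordHom (γ.dualGen z) v := by
    intro v
    induction v using FreeSemigroup.recOnMul with
    | ih1 p =>
      rcases p with ⟨b, _ | _⟩
      · simpa [wordHom] using hgen b
      · simpa [wordHom] using (hgen b).star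
    | ih2 p v hp hv => simp only [map_mul]; exact hp.mul hv
  induction w using induction_mono with
  | zero => simpa only [map_zero] using continuous_const
  | add x y hx hy => simp only [map_add]; exact hx.add hy
  | mono v c => simp only [lift_mono]; exact (hw v).const_smul c

/-- The dual action is point-norm continuous. -/
lemma continuous_dualAct (x : γ.CrossedProduct) : Continuous fun z => γ.dualAct z x := by
  refine continuous_of_uniform_approx_of_continuous fun u hu => ?_
  obtain ⟨ε, hε, hu⟩ := Metric.mem_uniformity_dist.1 hu
  obtain ⟨w, hw⟩ := (UnivCStar.isDenseInducing_of γ.bimodRel).dense.exists_dist_lt x hε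
  refine ⟨_, continuous_dualAct_ofHom (PreUniv.toFree _ w), fun z => hu ?_⟩
  rw [dist_eq_norm, ← map_sub]
  refine (NonUnitalStarAlgHom.norm_apply_le (γ.dualAct z) _).trans_lt ?_
  rwa [← dist_eq_norm]

/-! ### Normal forms of monomials in the crossed product -/

variable (γ) in
/-- Products of `n + 1` elements of `B_1`. -/
inductive PosProd : ℕ → γ.CrossedProduct → Prop
  | single {b} (hb : b ∈ γ.spectral 1) : PosProd 0 (γ.emb b)
  | cons {b n x} (hb : b ∈ γ.spectral 1) (hx : PosProd n x) : PosProd (n + 1) (γ.emb b * x)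

variable (γ) in
/-- Products of `n + 1` adjoints of elements of `B_1`. -/
inductive NegProd : ℕ → γ.CrossedProduct → Prop
  | single {b} (hb : b ∈ γ.spectral 1) : NegProd 0 (star (γ.emb b))
  | cons {b n x} (hb : b ∈ γ.spectral 1) (hx : NegProd n x) :
      NegProd (n + 1) (star (γ.emb b) * x)

lemma PosProd.dualAct {n : ℕ} {x : γ.CrossedProduct} (hx : γ.PosProd n x) (z : Circle) :
    γ.dualAct z x = (z : ℂ) ^ (n + 1 : ℤ) • x := by
  induction hx with
  | single hb => rw [dualAct_emb₁ z hb]; simp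
  | @cons b n x hb _ ih =>
    rw [map_mul, dualAct_emb₁ z hb, ih, smul_mul_smul_comm, Nat.cast_succ,
      zpow_add_one₀ z.coe_ne_zero (n + 1), mul_comm]

lemma NegProd.dualAct {n : ℕ} {x : γ.CrossedProduct} (hx : γ.NegProd n x) (z : Circle) :
    γ.dualAct z x = (z : ℂ) ^ (-(n + 1) : ℤ) • x := by
  have hs {b : UnivCStar R} (hb : b ∈ γ.spectral 1) :
      γ.dualAct z (star (γ.emb b)) = (z : ℂ) ^ (-1 : ℤ) • star (γ.emb b) := by
    rw [map_star, dualAct_emb₁ z hb, star_smul, ← star_coe_zpow, zpow_one]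
  induction hx with
  | single hb => rw [hs hb]; simp
  | @cons b n x hb _ ih =>
    rw [map_mul, hs hb, ih, smul_mul_smul_comm, ← zpow_add₀ z.coe_ne_zero]
    congr 2
    push_cast
    ring

lemma PosProd.fixed_mul {n : ℕ} {x : γ.CrossedProduct} (hx : γ.PosProd n x) {a : UnivCStar R}
    (ha : a ∈ γ.spectral 0) : γ.PosProd n (γ.emb a * x) := by
  cases hx with
  | single hb =>
    rw [← emb_left ha hb]
    exact .single (mul_mem₀₁ ha hb)
  | cons hb hx =>
    rw [← mul_assoc, ← emb_left ha hb]
    exact .cons (mul_mem₀₁ ha hb) hx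

lemma emb_mul_star_emb {a b : UnivCStar R} (ha : a ∈ γ.spectral 0) (hb : b ∈ γ.spectral 1) :
    γ.emb a * star (γ.emb b) = star (γ.emb (b * star a)) := by
  rw [emb_right hb (star_mem₀ ha), emb_star ha, star_mul, star_star]

lemma NegProd.fixed_mul {n : ℕ} {x : γ.CrossedProduct} (hx : γ.NegProd n x) {a : UnivCStar R}
    (ha : a ∈ γ.spectral 0) : γ.NegProd n (γ.emb a * x) := by
  cases hx with
  | @single b hb =>
    rw [emb_mul_star_emb ha hb]
    exact .single (mul_mem₁₀ hb (star_mem₀ ha))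
  | @cons b n x hb hx =>
    rw [← mul_assoc, emb_mul_star_emb ha hb]
    exact .cons (mul_mem₁₀ hb (star_mem₀ ha)) hx

variable (γ) in
/-- Elements of `B_0`, products of elements of `B_1`, and products of adjoints of elements
of `B_1`. -/
def IsNormalForm (x : γ.CrossedProduct) : Prop :=
  x ∈ Set.range γ.embFixed ∨ (∃ n, γ.PosProd n x) ∨ ∃ n, γ.NegProd n x

lemma isNormalForm_emb₀ {b : UnivCStar R} (hb : b ∈ γ.spectral 0) : γ.IsNormalForm (γ.emb b) :=
  .inl ⟨⟨b, hb⟩, rfl⟩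

lemma IsNormalForm.fixed_mul {x : γ.CrossedProduct} (hx : γ.IsNormalForm x) {a : UnivCStar R}
    (ha : a ∈ γ.spectral 0) : γ.IsNormalForm (γ.emb a * x) := by
  rcases hx with ⟨b, rfl⟩ | ⟨n, hx⟩ | ⟨n, hx⟩
  · rw [embFixed_apply, ← emb_mul ha b.2]
    exact isNormalForm_emb₀ (mul_mem₀₀ ha b.2)
  · exact .inr (.inl ⟨n, hx.fixed_mul ha⟩)
  · exact .inr (.inr ⟨n, hx.fixed_mul ha⟩)

/-- A factor from `B_1` cancels against an adjoint, since `B_1 B_1^* ⊆ B_0`. -/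
lemma IsNormalForm.emb_mul {x : γ.CrossedProduct} (hx : γ.IsNormalForm x) {a : UnivCStar R}
    (ha : a ∈ γ.spectral 1) : γ.IsNormalForm (γ.emb a * x) := by
  rcases hx with ⟨b, rfl⟩ | ⟨n, hx⟩ | ⟨n, hx⟩
  · rw [embFixed_apply, ← emb_right ha b.2]
    exact .inr (.inl ⟨0, .single (mul_mem₁₀ ha b.2)⟩)
  · exact .inr (.inl ⟨n + 1, .cons ha hx⟩)
  · cases hx with
    | single hb =>
      rw [← emb_innerL ha hb]
      exact isNormalForm_emb₀ (mul_star_mem₁₁ ha hb)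
    | @cons b n x hb hx =>
      rw [← mul_assoc, ← emb_innerL ha hb]
      exact .inr (.inr ⟨n, hx.fixed_mul (mul_star_mem₁₁ ha hb)⟩)

/-- An adjoint of an element of `B_1` cancels against a factor from `B_1`, since
`B_1^* B_1 ⊆ B_0`. -/
lemma IsNormalForm.star_emb_mul {x : γ.CrossedProduct} (hx : γ.IsNormalForm x)
    {a : UnivCStar R} (ha : a ∈ γ.spectral 1) : γ.IsNormalForm (star (γ.emb a) * x) := by
  rcases hx with ⟨b, rfl⟩ | ⟨n, hx⟩ | ⟨n, hx⟩
  · have hb' : star b.1 ∈ γ.spectral 0 := star_mem₀ b.2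
    have h : star (γ.emb a) * γ.emb b = star (γ.emb (star b.1 * a)) := by
      rw [emb_left hb' ha, emb_star b.2, star_mul, star_star]
    rw [embFixed_apply, h]
    exact .inr (.inr ⟨0, .single (mul_mem₀₁ hb' ha)⟩)
  · cases hx with
    | single hb =>
      rw [← emb_innerR ha hb]
      exact isNormalForm_emb₀ (star_mul_mem₁₁ ha hb)
    | @cons b n x hb hx =>
      rw [← mul_assoc, ← emb_innerR ha hb]
      exact .inr (.inl ⟨n, hx.fixed_mul (star_mul_mem₁₁ ha hb)⟩)
  · exact .inr (.inr ⟨n + 1, .cons ha hx⟩)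

lemma isNormalForm_wordHom (w : Word γ.BimodGen) :
    γ.IsNormalForm (wordHom (UnivCStar.gen γ.bimodRel) w) := by
  induction w using FreeSemigroup.recOnMul with
  | ih1 p =>
    obtain ⟨b, _ | _⟩ := p
    · change γ.IsNormalForm (UnivCStar.gen γ.bimodRel b)
      rw [← emb_coe]
      rcases b.2.1 with hb | hb
      · exact isNormalForm_emb₀ hb
      · exact .inr (.inl ⟨0, .single hb⟩)
    · change γ.IsNormalForm (star (UnivCStar.gen γ.bimodRel b))
      rw [← emb_coe]
      rcases b.2.1 with hb | hb
      · rw [← emb_star hb]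
        exact isNormalForm_emb₀ (star_mem₀ hb)
      · exact .inr (.inr ⟨0, .single hb⟩)
  | ih2 p w _ hw =>
    rw [map_mul]
    obtain ⟨b, _ | _⟩ := p
    · change γ.IsNormalForm (UnivCStar.gen γ.bimodRel b * _)
      rw [← emb_coe]
      exact b.2.1.elim hw.fixed_mul hw.emb_mul
    · change γ.IsNormalForm (star (UnivCStar.gen γ.bimodRel b) * _)
      rw [← emb_coe]
      rcases b.2.1 with hb | hb
      · rw [← emb_star hb]
        exact hw.fixed_mul (star_mem₀ hb)
      · exact hw.star_emb_mul hb

open scoped InnerProductSpace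

/-! ### Averaging over the dual action -/

lemma continuous_dualAct_exp (x : γ.CrossedProduct) :
    Continuous fun θ : ℝ => γ.dualAct (Circle.exp θ) x :=
  (continuous_dualAct x).comp Circle.exp.continuous

variable (γ) in
/-- The (unnormalised) average `∫ δ_{exp(iθ)}(x) dθ` over the dual action. -/
def average : γ.CrossedProduct →L[ℂ] γ.CrossedProduct :=
  LinearMap.mkContinuous
    { toFun := fun x => ∫ θ in (0 : ℝ)..2 * Real.pi, γ.dualAct (Circle.exp θ) x
      map_add' := fun x y => by
        simp only [map_add]
        exact intervalIntegral.integral_add ((continuous_dualAct_exp x).intervalIntegrable _ _)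
          ((continuous_dualAct_exp y).intervalIntegrable _ _)
      map_smul' := fun c x => by
        simp only [map_smul]
        exact intervalIntegral.integral_smul c _ }
    (2 * Real.pi) fun x => by
      have h := intervalIntegral.norm_integral_le_of_norm_le_const (a := 0) (b := 2 * Real.pi)
        (f := fun θ : ℝ => γ.dualAct (Circle.exp θ) x) (C := ‖x‖)
        fun θ _ => NonUnitalStarAlgHom.norm_apply_le _ x
      rw [sub_zero, abs_of_pos Real.two_pi_pos] at h
      exact h.trans_eq (mul_comm _ _)

lemma average_apply (x : γ.CrossedProduct) :
    γ.average x = ∫ θ in (0 : ℝ)..2 * Real.pi, γ.dualAct (Circle.exp θ) x := rfl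

lemma average_emb₀ {b : UnivCStar R} (hb : b ∈ γ.spectral 0) :
    γ.average (γ.emb b) = ((2 * Real.pi : ℝ) : ℂ) • γ.emb b := by
  simp only [average_apply, dualAct_emb₀ _ hb, intervalIntegral.integral_const, sub_zero]
  exact (Complex.coe_smul (2 * Real.pi) (γ.emb b)).symm

lemma average_eq_zero {n : ℤ} (hn : n ≠ 0) {x : γ.CrossedProduct}
    (hx : ∀ z, γ.dualAct z x = (z : ℂ) ^ n • x) : γ.average x = 0 := by
  have hc : (n * Complex.I : ℂ) ≠ 0 := mul_ne_zero (Int.cast_ne_zero.2 hn) Complex.I_ne_zero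
  have h (θ : ℝ) : γ.dualAct (Circle.exp θ) x = Complex.exp (n * Complex.I * θ) • x := by
    rw [hx, Circle.coe_exp, ← Complex.exp_int_mul]
    congr 2
    ring
  simp only [average_apply, h]
  rw [intervalIntegral.integral_smul_const, integral_exp_mul_complex hc]
  have h1 : Complex.exp (n * Complex.I * ((2 * Real.pi : ℝ) : ℂ)) = 1 := by
    rw [← Complex.exp_int_mul_two_pi_mul_I n]
    congr 1
    push_cast
    ring
  rw [h1, Complex.ofReal_zero, mul_zero, Complex.exp_zero, sub_self, zero_div, zero_smul]

lemma average_mem_of_isNormalForm {x : γ.CrossedProduct} (hx : γ.IsNormalForm x) :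
    γ.average x ∈ Set.range γ.embFixed := by
  rcases hx with ⟨b, rfl⟩ | ⟨n, hx⟩ | ⟨n, hx⟩
  · rw [embFixed_apply, average_emb₀ b.2]
    exact ⟨((2 * Real.pi : ℝ) : ℂ) • b, map_smul γ.embFixed _ b⟩
  · rw [average_eq_zero (by omega) hx.dualAct]
    exact ⟨0, map_zero _⟩
  · rw [average_eq_zero (by omega) hx.dualAct]
    exact ⟨0, map_zero _⟩

/-- The average takes values in the copy of `B_0`: this holds on monomials, and the copy of `B_0`
is closed. -/
lemma average_mem (x : γ.CrossedProduct) : γ.average x ∈ Set.range γ.embFixed := by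
  induction x using UnivCStar.induction_ofHom with
  | hp => exact isClosed_range_embFixed.preimage γ.average.continuous
  | ih w =>
    have hr : (Set.range γ.embFixed) = (NonUnitalStarAlgHom.range γ.embFixed : Set _) := rfl
    rw [hr, SetLike.mem_coe]
    induction w using induction_mono with
    | zero => rw [map_zero, map_zero]; exact zero_mem _
    | add x y hx hy => rw [map_add, map_add]; exact add_mem hx hy
    | mono v c =>
      have h : UnivCStar.ofHom γ.bimodRel (mono v c)
          = c • wordHom (UnivCStar.gen γ.bimodRel) v := by
        rw [← lift_mono]
        exact DFunLike.congr_fun (FreeStarAlg.hom_ext (ψ := lift (UnivCStar.gen γ.bimodRel))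
          fun b => by rw [lift_gen, UnivCStar.ofHom_gen]) _
      rw [h, map_smul]
      exact SMulMemClass.smul_mem c (average_mem_of_isNormalForm (isNormalForm_wordHom v))

/-- The average is faithful: in each representation the diagonal matrix coefficient of
`average (x^* x)` at `ξ` is the integral of the continuous non-negative function
`θ ↦ ‖δ_{exp(iθ)}(x) ξ‖²`. -/
lemma eq_zero_of_average_eq_zero {x : γ.CrossedProduct} (h : γ.average (star x * x) = 0) :
    x = 0 := by
  refine UnivCStar.eq_zero_of_ext fun π => ContinuousLinearMap.ext fun ξ => ?_
  let L : γ.CrossedProduct →L[ℂ] ℂ :=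
    (innerSL ℂ ξ).comp ((ContinuousLinearMap.apply ℂ π.H ξ).comp (homCLM π.ext))
  have hL (y : γ.CrossedProduct) : L (star y * y) = ((‖π.ext y ξ‖ ^ 2 : ℝ) : ℂ) := by
    change ⟪ξ, π.ext (star y * y) ξ⟫_ℂ = _
    rw [map_mul, map_star, mul_apply_eq_comp, ContinuousLinearMap.star_eq_adjoint,
      ContinuousLinearMap.adjoint_inner_right, inner_self_eq_norm_sq_to_K]
    simp
  let f : ℝ → ℝ := fun θ => ‖π.ext (γ.dualAct (Circle.exp θ) x) ξ‖ ^ 2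
  have hf : Continuous f :=
    ((((ContinuousLinearMap.apply ℂ π.H ξ).comp (homCLM π.ext)).continuous.comp
      (continuous_dualAct_exp x)).norm).pow 2
  have hint : ∫ θ in (0 : ℝ)..2 * Real.pi, f θ = 0 := by
    have h1 := L.intervalIntegral_comp_comm
      ((continuous_dualAct_exp (star x * x)).intervalIntegrable
        (μ := MeasureTheory.volume) 0 (2 * Real.pi))
    rw [← average_apply, h, map_zero] at h1
    simp only [map_mul, map_star, hL] at h1
    rw [intervalIntegral.integral_ofReal] at h1
    exact_mod_cast h1
  by_contra hne
  refine (intervalIntegral.integral_pos Real.two_pi_pos hf.continuousOn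
    (fun θ _ => sq_nonneg _) ⟨0, Set.left_mem_Icc.2 Real.two_pi_pos.le, ?_⟩).ne' hint
  have h0 : f 0 = ‖π.ext x ξ‖ ^ 2 := by
    simp only [f, Circle.exp_zero, dualAct_one]; rfl
  rw [h0]
  exact pow_pos (norm_pos_iff.2 hne) 2

/-- The canonical map is injective on the copy of `B_0` and intertwines the dual action with `γ`;
the faithful average over the dual action carries injectivity over to the crossed product. -/
lemma toUniv_injective : Function.Injective γ.toUniv := by
  rw [injective_iff_map_eq_zero]
  intro x hx
  apply eq_zero_of_average_eq_zero
  obtain ⟨b, hb⟩ := average_mem (star x * x)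
  have h : γ.toUniv (γ.average (star x * x)) = 0 := by
    rw [average_apply]
    have h1 := (homCLM γ.toUniv).intervalIntegral_comp_comm
      ((continuous_dualAct_exp (star x * x)).intervalIntegrable
        (μ := MeasureTheory.volume) 0 (2 * Real.pi))
    simp only [homCLM_apply, toUniv_dualAct, map_mul γ.toUniv, hx, mul_zero, map_zero,
      intervalIntegral.integral_zero] at h1
    exact h1.symm
  rw [← hb, embFixed_apply, toUniv_emb (.inl b.2)] at h
  rw [← hb, embFixed_apply, h, emb_zero]

/-! ### Semi-saturation and the uniqueness properties -/

lemma spectral_subset_range :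
    (γ.spectral 0 : Set (UnivCStar R)) ∪ γ.spectral 1 ⊆ Set.range γ.toUniv :=
  fun b hb => ⟨γ.emb b, toUniv_emb hb⟩

/-- The range of the canonical map is the `C^*`-algebra generated by `B_0 ∪ B_1`. -/
lemma coe_topologicalClosure_adjoin : ((NonUnitalStarAlgebra.adjoin ℂ
    ((γ.spectral 0 : Set (UnivCStar R)) ∪ γ.spectral 1)).topologicalClosure : Set (UnivCStar R))
      = Set.range γ.toUniv := by
  set S := NonUnitalStarAlgebra.adjoin ℂ ((γ.spectral 0 : Set (UnivCStar R)) ∪ γ.spectral 1)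
  refine subset_antisymm ?_ ?_
  · have hle : S ≤ NonUnitalStarAlgHom.range γ.toUniv :=
      NonUnitalStarAlgebra.adjoin_le spectral_subset_range
    exact closure_minimal (s := (S : Set (UnivCStar R))) hle
      (isClosed_range_of_injective toUniv_injective)
  · rintro _ ⟨x, rfl⟩
    induction x using UnivCStar.induction_ofHom with
    | hp =>
      exact (NonUnitalStarSubalgebra.isClosed_topologicalClosure S).preimage
        (continuous_hom γ.toUniv)
    | ih w =>
      refine NonUnitalStarSubalgebra.le_topologicalClosure S ?_
      have hval (b : γ.BimodGen) : b.1 ∈ S := NonUnitalStarAlgebra.subset_adjoin ℂ _ b.2.1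
      have hw (v : Word γ.BimodGen) : wordHom (fun b : γ.BimodGen => b.1) v ∈ S := by
        induction v using FreeSemigroup.recOnMul with
        | ih1 p =>
          rcases p with ⟨b, _ | _⟩
          · exact hval b
          · exact star_mem (hval b)
        | ih2 p v hp hv => rw [map_mul]; exact mul_mem hp hv
      rw [toUniv, UnivCStar.liftRel_ofHom]
      induction w using induction_mono with
      | zero => rw [map_zero]; exact zero_mem _
      | add x y hx hy => rw [map_add]; exact add_mem hx hy
      | mono v c => rw [lift_mono]; exact SMulMemClass.smul_mem c (hw v)

lemma toUniv_bijective_iff : Function.Bijective γ.toUniv ↔ γ.SemiSaturated := by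
  rw [SemiSaturated, ← SetLike.coe_set_eq, coe_topologicalClosure_adjoin]
  exact ⟨fun h => h.2.range_eq, fun h => ⟨toUniv_injective, Set.range_eq_univ.1 h⟩⟩

lemma gen_bimodRel_ne_zero (b : γ.BimodGen) : UnivCStar.gen γ.bimodRel b ≠ 0 := fun h =>
  b.2.2 (by rw [← toUniv_gen γ b, h, map_zero])

lemma ext_emb (ρ : Representation γ.bimodRel) (b : γ.BimodGen) : ρ.ext (γ.emb b.1) = ρ.op b := by
  rw [emb_coe, UnivCStar.ext_gen]

/-- A faithful representation of `(G_γ, R_γ)` is injective on the copy of `B_0`, so that it does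
not vanish on `g^* g ∈ B_0`. Hence it restricts to a faithful representation of `(G, R)`. -/
lemma injective_of_uniqueness (hsat : γ.SemiSaturated) (hg : ∀ g, UnivCStar.gen R g ≠ 0)
    (h : ∀ π : Representation R, π.Faithful → Function.Injective π.ext)
    (ρ : Representation γ.bimodRel) (hρ : ρ.Faithful) : Function.Injective ρ.ext := by
  let e := StarAlgEquiv.ofBijective γ.toUniv (toUniv_bijective_iff.2 hsat)
  let ψ : UnivCStar R →⋆ₙₐ[ℂ] (ρ.H →L[ℂ] ρ.H) :=
    ρ.ext.comp (e.symm : UnivCStar R →⋆ₙₐ[ℂ] γ.CrossedProduct)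
  have hψ (x : UnivCStar R) : ψ x = ρ.ext (e.symm x) := rfl
  have hfaith : (UnivCStar.toRepresentation ψ).Faithful := by
    intro g (h0 : ψ (UnivCStar.gen R g) = 0)
    set b := star (UnivCStar.gen R g) * UnivCStar.gen R g with hb
    have hb0 : b ∈ γ.spectral 0 := γ.star_gen_mul_gen_mem g
    have hbne : b ≠ 0 := (CStarRing.star_mul_self_ne_zero_iff _).2 (hg g)
    have hemb : e.symm b = γ.emb b :=
      e.injective ((e.apply_symm_apply b).trans (toUniv_emb (.inl hb0)).symm)
    have hz : ψ b = 0 := by rw [hb, map_mul, h0, mul_zero]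
    rw [hψ, hemb] at hz
    exact hρ ⟨b, .inl hb0, hbne⟩ ((ext_emb ρ ⟨b, .inl hb0, hbne⟩).symm.trans hz)
  have hinj := h _ hfaith
  rw [UnivCStar.ext_toRepresentation] at hinj
  intro x y hxy
  have hxy' : ψ (e x) = ψ (e y) := by
    rw [hψ, hψ, e.symm_apply_apply, e.symm_apply_apply, hxy]
  exact e.injective (hinj hxy')

/-- A faithful representation of `(G, R)` that is injective on `B_0` does not vanish on `b^* b` for
`0 ≠ b ∈ B_1`. Hence it induces a faithful representation of `(G_γ, R_γ)`. -/
lemma injective_of_gaugeInvarianceUniqueness (hsat : γ.SemiSaturated)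
    (hγ : γ.GaugeInvarianceUniqueness)
    (h : ∀ ρ : Representation γ.bimodRel, ρ.Faithful → Function.Injective ρ.ext)
    (π : Representation R) (hπ : π.Faithful) : Function.Injective π.ext := by
  have h₀ {b : UnivCStar R} (hb : b ∈ γ.spectral 0) (hz : π.ext b = 0) : b = 0 :=
    hγ π hπ hb (zero_mem (γ.spectral 0)) (by rw [hz, map_zero])
  have hfaith : (UnivCStar.toRepresentation (π.ext.comp γ.toUniv)).Faithful := by
    intro b (hb : π.ext (γ.toUniv (UnivCStar.gen γ.bimodRel b)) = 0)
    rw [toUniv_gen] at hb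
    rcases b.2.1 with hm | hm
    · exact b.2.2 (h₀ hm hb)
    · refine b.2.2 ((CStarRing.star_mul_self_eq_zero_iff _).1 (h₀ (star_mul_mem hm) ?_))
      rw [map_mul, hb, mul_zero]
  have hinj := h _ hfaith
  rw [UnivCStar.ext_toRepresentation] at hinj
  exact (Function.Injective.of_comp_iff' _ (toUniv_bijective_iff.2 hsat)).1 hinj

end CircleGaugeAction

end GenRel

end

theorem mainTheorem4 {G : Type u} (R : Set (GenRel.FreeStarAlg G)) [GenRel.Admissible R]
    (hR : GenRel.NonDegenerate R) (γ : GenRel.CircleGaugeAction R) :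
    (∃ Φ : γ.CrossedProduct →⋆ₙₐ[ℂ] GenRel.UnivCStar R,
      (∀ b : γ.BimodGen, Φ (GenRel.UnivCStar.gen γ.bimodRel b) = b.1) ∧
      (∀ Ψ : γ.CrossedProduct →⋆ₙₐ[ℂ] GenRel.UnivCStar R,
        (∀ b : γ.BimodGen, Ψ (GenRel.UnivCStar.gen γ.bimodRel b) = b.1) → Ψ = Φ) ∧
      Function.Injective Φ ∧
      (Function.Bijective Φ ↔ γ.SemiSaturated)) ∧
    GenRel.NonDegenerate γ.bimodRel ∧
    (γ.SemiSaturated →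
      (GenRel.UniquenessProperty R ↔
        γ.GaugeInvarianceUniqueness ∧ GenRel.UniquenessProperty γ.bimodRel)) := by
  have hg : ∀ g, GenRel.UnivCStar.gen R g ≠ 0 := hR.choose_spec.gen_ne_zero
  refine ⟨⟨γ.toUniv, γ.toUniv_gen, fun Ψ hΨ => ?_, γ.toUniv_injective,
    γ.toUniv_bijective_iff⟩, ?_, fun hsat => ?_⟩
  · exact GenRel.UnivCStar.hom_ext fun b => (hΨ b).trans (γ.toUniv_gen b).symm
  · obtain ⟨ρ, hρ⟩ := GenRel.Representation.exists_injective_ext γ.bimodRel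
    exact ⟨ρ, GenRel.Representation.faithful_of_injective_ext hρ γ.gen_bimodRel_ne_zero⟩
  · rw [GenRel.uniquenessProperty_iff hg, GenRel.uniquenessProperty_iff γ.gen_bimodRel_ne_zero]
    exact ⟨fun h => ⟨fun π hπ => (h π hπ).injOn,
        γ.injective_of_uniqueness hsat hg h⟩,
      fun ⟨hγ, h⟩ => γ.injective_of_gaugeInvarianceUniqueness hsat hγ h⟩
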